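/- **Setting.** There are $n$ participants; a static set $C$ of them is corrupt and controlled by an active, rushing, computationally unbounded adversary with its own random coins. Bit strings are added bitwise modulo $2$. An *AMD code* for $m$-bit messages with codeword length $\ell$ and error $2^{-s}$ consists of an encoder $F:\{0,1\}^m\to\{0,1\}^\ell$ using uniform random bits and a decoder $G:\{0,1\}^\ell\to\{0,1\}^m\cup\{\perp\}$ such that $G(F(w))=w$ always, and $\Pr[G(F(w)+\delta)\neq\perp]\le 2^{-s}$ for every $w$ and every $\delta\ne 0$. *Parity round* with inputs $x_i\in\{0,1\}$: each participant $i$ picks a uniform string $r_i\in\{0,1\}^n$ of parity $x_i$ and sends $r_i^j$ privately to $j$; then the participants announce, one after the other on a broadcast channel in a public order, $z_i=\bigoplus_j r_j^i$; the outcome is $\bigoplus_i z_i$. In each round the adversary sees the private bits sent by honest to corrupt participants and then chooses the private bits sent by the corrupt ones; a corrupt participant may adapt its announcement to everything seen so far, or refuse to announce. *Fixed role anonymous message transmission* (security parameter $s$, $m\ge1$): (1) $\ell$ parity rounds are executed, where in round $t$ a sender with message $w$ inputs the $t$-th bit of $F(w)$, a receiver inputs the $t$-th bit of a uniform mask $\rho\in\{0,1\}^\ell$,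 and everybody else inputs $0$ (a participant with both roles inputs the sum); if somebody refuses to broadcast, the protocol aborts after that round. Let $d$ be the string of outcomes. (2) A receiver computes $y=G(d+\rho)$. (3) Veto: for each of $n$ orderings with pairwise different last speakers, $s$ parity rounds are executed in that order; a receiver with $y=\perp$ inputs a fresh uniform bit each time, everybody else inputs $0$. If some outcome is $1$ or some participant refuses to broadcast, the protocol aborts; otherwise a receiver outputs $y$. The adversary's *view* consists of its coins and of everything it sees in all the rounds. **Lemma (Correctness, Privacy, Oracle).** For all $m\ge 2$ and $s\ge0$ there is an AMD code with error $2^{-s}$ and codeword length $\ell=m+2(\lceil\log_2 m\rceil+s)$. For all $n$, $s$, $\ell$, all $m\ge1$, every AMD code $(F,G)$ with these parameters, all speaking orders, every set $C$ and every adversary, the following hold. Let there be exactly one sender $S$, with message $w$, and exactly one receiver $R$ in (1)–(2). 1. (Correctness) If $S,R\notin C$, then the probability that the protocol does not abort and $R$ outputs a message different from $w$ is at most $2^{-s}$, and the probability that it does not abort and the output of $R$ is anything other than $w$ (possibly $\perp$) is at most $2\cdot2^{-s}$. 2. (Privacy) * (Perfect anonymity.) For a fixed $w$, the distribution of the view depends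 only on whether $S\in C$ and whether $R\in C$, not on who $S$ and $R$ are. * (Perfect privacy up to rejection.) There is a two-stage simulator such that for all $S,R\notin C$ and all $w$ the distribution of the view equals exactly that of the following ideal process, in which the simulator is given neither $w$ nor $S$ nor $R$: it outputs the coins and the view of the message rounds (1), together with either a string $\delta$ or an interruption; it is then told a single bit, namely whether $G(F(w)+\delta)=\perp$ for a fresh encoding $F(w)$ (in case of an interruption this bit is $1$); then it outputs the view of the veto. * If the corrupt participants follow the protocol (parity with input $0$; passive adversary), then for $S,R\notin C$ the distribution of the view does not depend on $S$, $R$ and $w$ at all. * For an arbitrary active adversary, the view distributions for any two triples $(S,R,w)$ and $(S',R',w')$ with $S,R,S',R'\notin C$ have total variation distance at most $2^{-s}$. 3. (Oracle) If there is at least one honest receiver, and more than one honest participant acts as a sender (with arbitrary messages) or more than one honest participant acts as a receiver, then the protocol aborts except with probability at most $3\cdot2^{-s}$. -/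

import Mathlib

open scoped ENNReal

/-- Bit strings of length `k`; addition is the bitwise exclusive or. -/
abbrev Word (k : ℕ) : Type := Fin k → ZMod 2

/-- The probability of the event `E`. -/
noncomputable def Pr {α : Type} (p : PMF α) (E : Set α) : ℝ≥0∞ := p.toOuterMeasure E

/-- An algebraic manipulation detection code for `m`-bit messages with `ℓ`-bit codewords and error
`2 ^ (-s)`. The encoder is probabilistic: its second argument is a string of `coins` random bits.
The decoder answers `none` when it detects a manipulation. -/
structure AMDCode (m ℓ s : ℕ) where
  coins : ℕ
  encode : Word m → Word coins → Word ℓ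
  decode : Word ℓ → Option (Word m)
  decode_encode : ∀ w e, decode (encode w e) = some w
  detect : ∀ (w : Word m) (δ : Word ℓ), δ ≠ 0 →
    Pr (PMF.uniformOfFintype (Word coins)) {e | decode (encode w e + δ) ≠ none} ≤ (2⁻¹ : ℝ≥0∞) ^ s

section Parity

/-- `M i j` is the bit that participant `i` sends to participant `j` on their private channel. -/
abbrev ShareMatrix (n : ℕ) : Type := Fin n → Fin n → ZMod 2

/-- The announcements on the broadcast channel in one round, in the order in which they are made.
`none` is a refusal to broadcast. -/
abbrev Transcript (n : ℕ) : Type := List (Fin n × Option (ZMod 2))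

/-- What the adversary sees in one round of parity: the bits that honest participants send to
corrupt ones (all other entries of the matrix are `0`), and all announcements. -/
abbrev RoundLog (n : ℕ) : Type := ShareMatrix n × Transcript n

/-- A static, active, rushing adversary with unlimited computing power. It draws its own random
coins once and then plays all the corrupt participants. In every round it knows its coins, the logs
of all the earlier rounds and the private bits that honest participants send to corrupt ones in this
round. From these it computes the bits that the corrupt participants send (`share`), and, when it is
the turn of a corrupt participant to speak, the announcement of that participant, which may depend
on the earlier announcements of the round, or the refusal to announce anything (`announce`). -/
structure Adversary (n : ℕ) where
  Coin : Type
  coin : PMF Coin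
  share : Coin → List (RoundLog n) → ShareMatrix n → ShareMatrix n
  announce : Coin → List (RoundLog n) → ShareMatrix n → Transcript n → Fin n → Option (ZMod 2)

variable {n : ℕ}

/-- The adversary is passive on the corrupt set `C`: in every round, the corrupt participants follow
the parity protocol with input `0`. -/
def Adversary.Passive (A : Adversary n) (C : Finset (Fin n)) : Prop :=
  (∀ c h q, ∀ i ∈ C, ∑ j, A.share c h q i j = 0) ∧
  (∀ c h q t, ∀ i ∈ C,
    A.announce c h q t i = some (∑ j, if j ∈ C then A.share c h q j i else q j i))

/-- The matrices whose row `i` has parity `x i`, for each `i`. -/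
def sharings (x : Fin n → ZMod 2) : Finset (ShareMatrix n) :=
  Finset.univ.filter fun r => ∀ i, ∑ j, r i j = x i

theorem sharings_nonempty (x : Fin n → ZMod 2) : (sharings x).Nonempty :=
  ⟨fun i j => if j = i then x i else 0, by simp [sharings]⟩

/-- The broadcasts of one round. The participants in the list speak one after the other: an honest
`i` announces `z i`, a corrupt one announces what `adv` says. -/
def broadcast (C : Finset (Fin n)) (z : Fin n → ZMod 2)
    (adv : Transcript n → Fin n → Option (ZMod 2)) :
    List (Fin n) → Transcript n → Transcript n
  | [], t => t
  | i :: L, t => broadcast C z adv L (t ++ [(i, if i ∈ C then adv t i else some (z i))])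

/-- The public outcome of a round: the parity of all announced bits, or `none` if some participant
refused to broadcast. -/
def outcome (t : Transcript n) : Option (ZMod 2) :=
  if ∃ p ∈ t, p.2 = none then none else some (t.map fun p => p.2.getD 0).sum

/-- One round of parity with inputs `x`, with regular broadcast in the order `σ` (`σ 0` speaks
first), and with corrupt set `C`; the entries `x i` for `i ∈ C` have no influence. -/
noncomputable def parityRound (C : Finset (Fin n)) (A : Adversary n) (c : A.Coin)
    (h : List (RoundLog n)) (σ : Equiv.Perm (Fin n)) (x : Fin n → ZMod 2) : PMF (RoundLog n) :=
  (PMF.uniformOfFinset (sharings x) (sharings_nonempty x)).map fun r =>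
    let seen : ShareMatrix n := fun i j => if i ∉ C ∧ j ∈ C then r i j else 0
    let sent : ShareMatrix n := fun i j => if i ∈ C then A.share c h seen i j else r i j
    (seen, broadcast C (fun i => ∑ j, sent j i) (A.announce c h seen) (List.ofFn σ) [])

end Parity

section Protocol

/-- The public speaking orders: one for each of the `ℓ` rounds that carry the message, and the `n`
orderings of the veto, which have pairwise different last participants. -/
structure Schedule (n ℓ : ℕ) where
  parity : Fin ℓ → Equiv.Perm (Fin n)
  veto : Fin n → Equiv.Perm (Fin n)
  veto_last : Function.Injective fun k => (List.ofFn (veto k)).getLast?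

/-- Who believes to be a sender (and with which message), and who believes to be a receiver. Only
the roles of honest participants have an influence on the protocol. -/
structure Roles (n m : ℕ) where
  send : Fin n → Option (Word m)
  recv : Finset (Fin n)

/-- The roles when the oracle conditions hold: `S` is the only sender, with message `w`, and `R` is
the only receiver. -/
def Roles.unique {n m : ℕ} (S R : Fin n) (w : Word m) : Roles n m where
  send i := if i = S then some w else none
  recv := {R}

/-- The view of the adversary: its coins, the logs of the message rounds, the logs of the veto. -/
abbrev View {n : ℕ} (A : Adversary n) : Type := A.Coin × List (RoundLog n) × List (RoundLog n)

/-- A completed execution: the view of the adversary, whether the protocol aborted, and the string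
`y` that each participant would have as its output if it is a receiver and the protocol did not
abort. -/
structure Execution {n : ℕ} (A : Adversary n) (m : ℕ) where
  view : View A
  aborted : Bool
  decoded : Fin n → Option (Word m)

variable {n m ℓ s : ℕ}

/-- The rounds of parity that carry the message, where participant `i` has input `x i t` in round
`t`. If a participant refuses to broadcast in some round, then the protocol aborts after this
round, and the second component of the result is `none`. -/
noncomputable def messagePhase (C : Finset (Fin n)) (A : Adversary n) (c : A.Coin)
    (ord : Fin ℓ → Equiv.Perm (Fin n)) (x : Fin n → Word ℓ) :
    PMF (List (RoundLog n) × Option (Word ℓ)) :=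
  (List.finRange ℓ).foldlM
    (fun (st : List (RoundLog n) × Option (Word ℓ)) (t : Fin ℓ) =>
      match st.2 with
      | none => PMF.pure st
      | some d => (parityRound C A c st.1 (ord t) fun i => x i t).map fun v =>
          (st.1 ++ [v], (outcome v.2).map fun b => Function.update d t b))
    ([], some 0)

/-- The veto with inputs `v`, after the rounds logged in `h`: for each of the orderings, `s` rounds
of parity, where a participant with input `true` uses a fresh random bit and a participant with
input `false` uses `0`. The result is `true` if some round had outcome `1` or a refusal. -/
noncomputable def vetoPhase (s : ℕ) (C : Finset (Fin n)) (A : Adversary n) (c : A.Coin)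
    (h : List (RoundLog n)) (ord : Fin n → Equiv.Perm (Fin n)) (v : Fin n → Bool) :
    PMF (List (RoundLog n) × Bool) :=
  ((List.finRange n).flatMap fun k => List.replicate s (ord k)).foldlM
    (fun (st : List (RoundLog n) × Bool) (σ : Equiv.Perm (Fin n)) =>
      (PMF.uniformOfFintype (Fin n → ZMod 2)).bind fun q =>
        (parityRound C A c (h ++ st.1) σ fun i => if v i then q i else 0).map fun u =>
          (st.1 ++ [u], st.2 || decide (outcome u.2 ≠ some 0)))
    ([], false)

/-- The input words of the participants for the message rounds, where `e i` are the coins of `i` for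
the encoding and `ρ i` is the mask of `i`. -/
def inputWord (F : AMDCode m ℓ s) (roles : Roles n m) (e : Fin n → Word F.coins)
    (ρ : Fin n → Word ℓ) (i : Fin n) : Word ℓ :=
  (match roles.send i with
    | none => 0
    | some w => F.encode w (e i)) + (if i ∈ roles.recv then ρ i else 0)

/-- The fixed role anonymous message transmission protocol with code `F`, speaking orders `sch`,
roles `roles`, and with the participants in `C` controlled by the adversary `A`. -/
noncomputable def fixedRoleAMT (F : AMDCode m ℓ s) (sch : Schedule n ℓ) (C : Finset (Fin n))
    (A : Adversary n) (roles : Roles n m) : PMF (Execution A m) :=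
  A.coin.bind fun c =>
  (PMF.uniformOfFintype (Fin n → Word F.coins)).bind fun e =>
  (PMF.uniformOfFintype (Fin n → Word ℓ)).bind fun ρ =>
  (messagePhase C A c sch.parity (inputWord F roles e ρ)).bind fun p =>
    match p.2 with
    | none => PMF.pure ⟨(c, p.1, []), true, fun _ => none⟩
    | some d =>
      let y : Fin n → Option (Word m) := fun i => F.decode (d + ρ i)
      (vetoPhase s C A c p.1 sch.veto fun i => decide (i ∈ roles.recv) && (y i).isNone).map
        fun q => ⟨(c, p.1, q.1), q.2, y⟩

/-- The distribution of the view of the adversary. -/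
noncomputable def viewLaw (F : AMDCode m ℓ s) (sch : Schedule n ℓ) (C : Finset (Fin n))
    (A : Adversary n) (roles : Roles n m) : PMF (View A) :=
  (fixedRoleAMT F sch C A roles).map Execution.view

/-- The one bit that the ideal process gives to a simulator: whether the decoder rejects a fresh
encoding of `w` manipulated by `δ`. For `none` (the transmission is interrupted) it is `true`. -/
noncomputable def rejection (F : AMDCode m ℓ s) (w : Word m) : Option (Word ℓ) → PMF Bool
  | none => PMF.pure true
  | some δ => (PMF.uniformOfFintype (Word F.coins)).map fun e =>
      (F.decode (F.encode w e + δ)).isNone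

/-- The output of a simulator in the ideal process with message `w`: the first stage gives the coins,
the logs of the message rounds and a manipulation of the codeword; after being told the rejection
bit, the second stage gives the logs of the veto. The simulator knows neither the message nor the
identities of the sender and the receiver. -/
noncomputable def idealView {A : Adversary n} (F : AMDCode m ℓ s) (w : Word m)
    (sim₁ : PMF ((A.Coin × List (RoundLog n)) × Option (Word ℓ)))
    (sim₂ : A.Coin × List (RoundLog n) → Bool → PMF (List (RoundLog n))) : PMF (View A) :=
  sim₁.bind fun a => (rejection F w a.2).bind fun b =>
    (sim₂ a.1 b).map fun v => (a.1.1, a.1.2, v)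

end Protocol

/-! Everything rests on two facts about one parity round. Adding a vector to a column of the share
matrix that is addressed to an honest participant is invisible to the adversary, so the log depends
on the honest inputs only through their sum (`parityRound_congr`). If that participant speaks last,
its announcement is fixed only after the adversary has finished, so flipping its input flips the
outcome (`Pr_outcome_add_single`); hence a vetoing round shows outcome 0 with probability at most
one half (`Pr_outcome_zero_le`). Every participant is last in one veto ordering, so a veto is missed
with probability at most `2⁻¹ ^ s` (`Pr_vetoPhase_le`).

With one honest sender and one honest receiver, the honest sum `u = F(w) + ρ` is uniform and
independent of the encoding coins. The outcome `d` is therefore chosen independently of these coins,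
and the receiver decodes `F(w) + δ` with `δ = d + u`, which is exactly the situation of the AMD
code. This gives correctness, and also the simulator: it draws `u` itself and needs only the
rejection bit. That bit is constant if `δ = 0`, and almost constant otherwise.

With a second honest receiver, the mask of the first is uniform given the outcomes. With a second
honest sender, its encoding acts as a random manipulation that is rarely zero. Either way a receiver
accepts with probability at most `2 * 2⁻¹ ^ s`.

The code appends to the message a random key and a polynomial tag; undetected manipulations are
roots of a nonzero polynomial in the key (`card_tag_le`). -/

section Probability

/-! ### Calculus of discrete probability laws -/

variable {α β : Type}

theorem Pr_bind (p : PMF α) (f : α → PMF β) (E : Set β) :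
    Pr (p.bind f) E = ∑' a, p a * Pr (f a) E :=
  PMF.toOuterMeasure_bind_apply ..

theorem Pr_map (p : PMF α) (f : α → β) (E : Set β) : Pr (p.map f) E = Pr p (f ⁻¹' E) :=
  PMF.toOuterMeasure_map_apply ..

theorem Pr_mono (p : PMF α) {E E' : Set α} (h : E ⊆ E') : Pr p E ≤ Pr p E' :=
  p.toOuterMeasure.mono h

theorem Pr_le_one (p : PMF α) (E : Set α) : Pr p E ≤ 1 :=
  (p.toOuterMeasure_apply_eq_one_iff Set.univ).2 (Set.subset_univ _) ▸
    Pr_mono p (Set.subset_univ E)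

theorem Pr_pure (a : α) (E : Set α) [Decidable (a ∈ E)] :
    Pr (PMF.pure a) E = if a ∈ E then 1 else 0 := by
  classical
  rw [Pr, PMF.toOuterMeasure_pure_apply]
  congr

theorem Pr_bind_le_mul (p : PMF α) (f : α → PMF β) (E : Set β) (B : Set α) (ε : ℝ≥0∞)
    (h : ∀ a ∈ B, Pr (f a) E ≤ ε) (h' : ∀ a ∉ B, Pr (f a) E = 0) :
    Pr (p.bind f) E ≤ Pr p B * ε := by
  rw [Pr_bind, Pr, PMF.toOuterMeasure_apply, ← ENNReal.tsum_mul_right]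
  refine ENNReal.tsum_le_tsum fun a => ?_
  by_cases ha : a ∈ B
  · simpa [ha] using by gcongr; exact h a ha
  · simp [h' a ha]

theorem Pr_bind_le_add (p : PMF α) (f : α → PMF β) (E : Set β) (B : Set α) (ε : ℝ≥0∞)
    (h : ∀ a ∉ B, Pr (f a) E ≤ ε) : Pr (p.bind f) E ≤ Pr p B + ε := by
  have hε : ε = ∑' a, p a * ε := by rw [ENNReal.tsum_mul_right, p.tsum_coe, one_mul]
  rw [Pr_bind, hε, Pr, PMF.toOuterMeasure_apply, ← ENNReal.tsum_add]
  refine ENNReal.tsum_le_tsum fun a => ?_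
  by_cases ha : a ∈ B
  · rw [Set.indicator_of_mem ha]
    exact (mul_le_of_le_one_right' (Pr_le_one _ _)).trans le_self_add
  · rw [Set.indicator_of_notMem ha, zero_add]
    gcongr
    exact h a ha

theorem Pr_bind_le (p : PMF α) (f : α → PMF β) (E : Set β) (ε : ℝ≥0∞)
    (h : ∀ a, Pr (f a) E ≤ ε) : Pr (p.bind f) E ≤ ε := by
  simpa [Pr] using Pr_bind_le_add p f E ∅ ε fun a _ => h a

theorem Pr_bind_mono_add (p : PMF α) (f g : α → PMF β) (E : Set β) (ε : ℝ≥0∞)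
    (h : ∀ a, Pr (f a) E ≤ Pr (g a) E + ε) : Pr (p.bind f) E ≤ Pr (p.bind g) E + ε := by
  have hε : ε = ∑' a, p a * ε := by rw [ENNReal.tsum_mul_right, p.tsum_coe, one_mul]
  rw [Pr_bind, Pr_bind, hε, ← ENNReal.tsum_add]
  refine ENNReal.tsum_le_tsum fun a => ?_
  rw [← mul_add]
  gcongr
  exact h a

theorem bind_congr_fun (p : PMF α) {f g : α → PMF β} (h : ∀ a, f a = g a) : p.bind f = p.bind g :=
  congrArg _ (funext h)

/-- Allows the use of facts that hold only almost surely, such as invariants of the message rounds.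
-/
theorem bind_congr_support (p : PMF α) (f g : α → PMF β) (h : ∀ a ∈ p.support, f a = g a) :
    p.bind f = p.bind g := by
  ext b
  rw [PMF.bind_apply, PMF.bind_apply]
  refine tsum_congr fun a => ?_
  by_cases ha : a ∈ p.support
  · rw [h a ha]
  · simp [(p.apply_eq_zero_iff a).2 ha]

theorem Pr_uniform [Fintype α] [Nonempty α] (E : Set α) [DecidablePred (· ∈ E)] :
    Pr (PMF.uniformOfFintype α) E
      = (Finset.univ.filter (· ∈ E)).card / (Fintype.card α : ℝ≥0∞) := by
  rw [Pr, PMF.toOuterMeasure_uniformOfFintype_apply, Fintype.card_subtype]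

theorem uniformOfFinset_map_of_bijOn {s : Finset α} {t : Finset β} (hs : s.Nonempty)
    (ht : t.Nonempty) (f : α → β) (h : Set.BijOn f s t) :
    (PMF.uniformOfFinset s hs).map f = PMF.uniformOfFinset t ht := by
  classical
  ext b
  have hcard : s.card = t.card := Finset.card_bij (fun a _ => f a) (fun a ha => h.mapsTo ha)
    (fun a ha b hb hab => h.injOn ha hb hab) fun b hb => by
      obtain ⟨a, ha, hab⟩ := h.surjOn hb
      exact ⟨a, ha, hab⟩
  rw [PMF.map_apply, PMF.uniformOfFinset_apply]
  split_ifs with hb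
  · obtain ⟨a, ha, rfl⟩ := h.surjOn hb
    rw [tsum_eq_single a, if_pos rfl, PMF.uniformOfFinset_apply, if_pos (by exact ha), hcard]
    intro a' ha'
    split_ifs with hf
    · rw [PMF.uniformOfFinset_apply, if_neg]
      exact fun hm => ha' (h.injOn hm ha hf.symm)
    · rfl
  · rw [ENNReal.tsum_eq_zero]
    intro a
    split_ifs with hf
    · rw [PMF.uniformOfFinset_apply, if_neg]
      rintro ha
      exact hb (hf ▸ h.mapsTo ha)
    · rfl

theorem uniform_map_equiv [Fintype α] [Nonempty α] [Fintype β] [Nonempty β] (f : α ≃ β) :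
    (PMF.uniformOfFintype α).map f = PMF.uniformOfFintype β :=
  uniformOfFinset_map_of_bijOn _ _ f (by simp [Set.bijOn_univ])

theorem uniform_bind_equiv [Fintype α] [Nonempty α] (f : α ≃ α) (g : α → PMF β) :
    (PMF.uniformOfFintype α).bind (fun a => g (f a)) = (PMF.uniformOfFintype α).bind g := by
  conv_rhs => rw [← uniform_map_equiv f, PMF.bind_map]
  rfl

theorem uniform_bind_add_right [Fintype α] [AddGroup α] (x : α) (g : α → PMF β) :
    (PMF.uniformOfFintype α).bind (fun a => g (a + x)) = (PMF.uniformOfFintype α).bind g :=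
  uniform_bind_equiv (Equiv.addRight x) g

theorem bind_const' (p : PMF α) (q : PMF β) : (p.bind fun _ => q) = q := by simp

theorem bind_pure_eq_map (p : PMF α) (f : α → β) : (p.bind fun a => PMF.pure (f a)) = p.map f :=
  PMF.bind_pure_comp f p

theorem uniform_prod [Fintype α] [Nonempty α] [Fintype β] [Nonempty β] :
    PMF.uniformOfFintype (α × β) = (PMF.uniformOfFintype α).bind fun a =>
      (PMF.uniformOfFintype β).map fun b => (a, b) := by
  classical
  ext ⟨a, b⟩
  simp only [PMF.bind_apply, PMF.map_apply, PMF.uniformOfFintype_apply, Prod.mk.injEq]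
  rw [tsum_eq_single a, tsum_eq_single b]
  · simp [ENNReal.mul_inv]
  · intro b' hb
    simp [hb.symm]
  · intro a' ha
    simp [ha.symm]

/-- A uniform function may be resampled at one place. -/
theorem uniform_bind_update {ι : Type} [Fintype ι] [DecidableEq ι] [Fintype α] [Nonempty α] (i : ι)
    (g : (ι → α) → PMF β) :
    (PMF.uniformOfFintype (ι → α)).bind g = (PMF.uniformOfFintype (ι → α)).bind fun h =>
      (PMF.uniformOfFintype α).bind fun a => g (Function.update h i a) := by
  have hE := uniform_map_equiv (Equiv.funSplitAt i α).symm
  rw [uniform_prod] at hE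
  -- Coordinate `i` is drawn independently of the others; on the resampled side its first value is
  -- discarded.
  have key : ∀ k : (ι → α) → PMF β, (PMF.uniformOfFintype (ι → α)).bind k =
      (PMF.uniformOfFintype α).bind fun a =>
        (PMF.uniformOfFintype ({j // j ≠ i} → α)).bind fun h =>
          k ((Equiv.funSplitAt i α).symm (a, h)) := by
    intro k
    conv_lhs => rw [← hE]
    simp only [PMF.map_bind, PMF.bind_bind, PMF.map_comp, PMF.bind_map]
    rfl
  rw [key, key, PMF.bind_comm]
  conv_rhs => rw [PMF.bind_comm]
  congr 1
  funext h
  conv_rhs => rw [PMF.bind_comm]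
  refine (bind_const' (PMF.uniformOfFintype α) _).symm.trans ?_
  rw [PMF.bind_comm]
  congr 1
  funext a
  congr 1
  funext b
  congr 1
  funext j
  by_cases hj : j = i <;> simp [Equiv.funSplitAt, Equiv.piSplitAt, hj, Function.update]

theorem uniform_bind_eval {ι : Type} [Fintype ι] [DecidableEq ι] [Fintype α] [Nonempty α] (i : ι)
    (g : α → PMF β) :
    ((PMF.uniformOfFintype (ι → α)).bind fun h => g (h i)) = (PMF.uniformOfFintype α).bind g := by
  rw [uniform_bind_update i]
  simp

end Probability

/-! ### One round of parity -/

section Round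

variable {n : ℕ}

theorem broadcast_congr (C : Finset (Fin n)) {z z' : Fin n → ZMod 2}
    (adv : Transcript n → Fin n → Option (ZMod 2)) (L : List (Fin n)) (t : Transcript n)
    (h : ∀ i ∈ L, i ∉ C → z i = z' i) : broadcast C z adv L t = broadcast C z' adv L t := by
  induction L generalizing t with
  | nil => rfl
  | cons i L ih =>
    have hi : (if i ∈ C then adv t i else some (z i)) = if i ∈ C then adv t i else some (z' i) := by
      split_ifs with hc
      · rfl
      · rw [h i (by simp) hc]
    rw [broadcast, broadcast, hi]
    exact ih _ fun j hj => h j (List.mem_cons_of_mem _ hj)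

theorem broadcast_append (C : Finset (Fin n)) (z : Fin n → ZMod 2)
    (adv : Transcript n → Fin n → Option (ZMod 2)) (L L' : List (Fin n)) (t : Transcript n) :
    broadcast C z adv (L ++ L') t = broadcast C z adv L' (broadcast C z adv L t) := by
  induction L generalizing t with
  | nil => rfl
  | cons i L ih => exact ih _

theorem broadcast_eq_map (C : Finset (Fin n)) (z : Fin n → ZMod 2)
    (adv : Transcript n → Fin n → Option (ZMod 2)) (L : List (Fin n)) (t : Transcript n)
    (h : ∀ t, ∀ i ∈ C, adv t i = some (z i)) :
    broadcast C z adv L t = t ++ L.map fun i => (i, some (z i)) := by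
  induction L generalizing t with
  | nil => simp [broadcast]
  | cons i L ih =>
    rw [broadcast, ih]
    by_cases hi : i ∈ C <;> simp [hi, h]

theorem outcome_append_some (t : Transcript n) (i : Fin n) (b : ZMod 2) :
    outcome (t ++ [(i, some b)]) = (outcome t).map (· + b) := by
  by_cases h : ∃ p ∈ t, p.2 = none
  · have h' : ∃ p ∈ t ++ [(i, some b)], p.2 = none := by
      obtain ⟨p, hp, hn⟩ := h
      exact ⟨p, by simp [hp], hn⟩
    rw [outcome, outcome, if_pos h, if_pos h', Option.map_none]
  · have h' : ¬ ∃ p ∈ t ++ [(i, some b)], p.2 = none := by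
      rintro ⟨p, hp, hn⟩
      rcases List.mem_append.1 hp with hp | hp
      · exact h ⟨p, hp, hn⟩
      · rw [List.mem_singleton.1 hp] at hn
        simp at hn
    rw [outcome, outcome, if_neg h, if_neg h']
    simp

theorem outcome_map_some (L : List (Fin n)) (z : Fin n → ZMod 2) :
    outcome (L.map fun i => (i, some (z i))) = some (L.map z).sum := by
  rw [outcome, if_neg (by simp), List.map_map]
  rfl

/-- What is sent on the channels from honest to corrupt participants. -/
def seenOf (C : Finset (Fin n)) (r : ShareMatrix n) : ShareMatrix n :=
  fun i j => if i ∉ C ∧ j ∈ C then r i j else 0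

/-- What is sent on all the private channels. -/
def sentOf (C : Finset (Fin n)) (A : Adversary n) (c : A.Coin) (h : List (RoundLog n))
    (r : ShareMatrix n) : ShareMatrix n :=
  fun i j => if i ∈ C then A.share c h (seenOf C r) i j else r i j

/-- The log of the round of parity in which the honest participants share their inputs as in `r`. -/
def logOf (C : Finset (Fin n)) (A : Adversary n) (c : A.Coin) (h : List (RoundLog n))
    (σ : Equiv.Perm (Fin n)) (r : ShareMatrix n) : RoundLog n :=
  (seenOf C r, broadcast C (fun i => ∑ j, sentOf C A c h r j i) (A.announce c h (seenOf C r))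
    (List.ofFn σ) [])

variable (C : Finset (Fin n)) (A : Adversary n) (c : A.Coin) (h : List (RoundLog n))
  (σ : Equiv.Perm (Fin n))

theorem parityRound_eq_map (x : Fin n → ZMod 2) :
    parityRound C A c h σ x
      = (PMF.uniformOfFinset (sharings x) (sharings_nonempty x)).map (logOf C A c h σ) :=
  rfl

theorem mem_sharings {x : Fin n → ZMod 2} {r : ShareMatrix n} :
    r ∈ sharings x ↔ ∀ i, ∑ j, r i j = x i := by
  simp [sharings]

/-- Adding a vector to one column of the share matrix changes the inputs by this vector. -/
theorem bijOn_sharings (x v : Fin n → ZMod 2) (j₀ : Fin n) :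
    Set.BijOn (fun (r : ShareMatrix n) i j => r i j + if j = j₀ then v i else 0)
      (sharings x) (sharings (x + v)) := by
  refine ⟨fun r hr => ?_, fun r _ r' _ hrr => ?_, fun r hr => ?_⟩
  · rw [Finset.mem_coe, mem_sharings] at hr ⊢
    intro i
    simp [Finset.sum_add_distrib, hr i]
  · funext i j
    exact add_right_cancel (congrFun (congrFun hrr i) j)
  · rw [Finset.mem_coe, mem_sharings] at hr
    refine ⟨fun i j => r i j - if j = j₀ then v i else 0, ?_, ?_⟩
    · rw [Finset.mem_coe, mem_sharings]
      intro i
      simp [hr i]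
    · funext i j
      simp

theorem sum_sentOf_congr {r r' : ShareMatrix n} (hs : seenOf C r = seenOf C r') (i : Fin n)
    (hr : ∑ j ∈ Cᶜ, r j i = ∑ j ∈ Cᶜ, r' j i) :
    ∑ j, sentOf C A c h r j i = ∑ j, sentOf C A c h r' j i := by
  rw [← Finset.sum_add_sum_compl C, ← Finset.sum_add_sum_compl C (fun j => sentOf C A c h r' j i)]
  congr 1
  · refine Finset.sum_congr rfl fun j hj => ?_
    simp [sentOf, hj, hs]
  · convert hr using 1 <;>
    · refine Finset.sum_congr rfl fun j hj => ?_
      simp [sentOf, Finset.mem_compl.1 hj]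

/-- All corrupt behaviour is a function of what is seen. Beyond that, honest shares enter the log
only through the announcements of honest participants, which are column sums. -/
theorem logOf_congr {r r' : ShareMatrix n} (hs : seenOf C r = seenOf C r')
    (hr : ∀ i ∉ C, ∑ j ∈ Cᶜ, r j i = ∑ j ∈ Cᶜ, r' j i) :
    logOf C A c h σ r = logOf C A c h σ r' := by
  rw [logOf, logOf, hs]
  congr 1
  exact broadcast_congr _ _ _ _ fun i _ hi => sum_sentOf_congr C A c h hs i (hr i hi)

/-- The log of a round depends on the inputs of the honest participants only through their sum. -/
theorem parityRound_congr {x x' : Fin n → ZMod 2} (hx : ∑ i ∈ Cᶜ, x i = ∑ i ∈ Cᶜ, x' i) :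
    parityRound C A c h σ x = parityRound C A c h σ x' := by
  rw [parityRound_eq_map, parityRound_eq_map]
  by_cases hC : ∃ j, j ∉ C
  · obtain ⟨j₀, hj₀⟩ := hC
    -- Correcting the inputs in the column of the honest `j₀` changes nothing that is seen, and the
    -- honest part of this column sum changes by the honest sum of `x' - x`, which is zero.
    have hb := bijOn_sharings x (x' - x) j₀
    rw [add_sub_cancel] at hb
    rw [← uniformOfFinset_map_of_bijOn (sharings_nonempty x) (sharings_nonempty x') _ hb,
      PMF.map_comp]
    congr 1
    funext r
    refine logOf_congr _ _ _ _ _ ?_ fun i _ => ?_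
    · funext i j
      unfold seenOf
      split_ifs with hij
      · have hj : j ≠ j₀ := fun he => hj₀ (he ▸ hij.2)
        simp [hj]
      · rfl
    · rw [Finset.sum_add_distrib]
      split_ifs
      · simp [hx]
      · simp
  · push Not at hC
    -- With everybody corrupt the log does not depend on the honest shares at all.
    have hconst : logOf C A c h σ = Function.const _ (logOf C A c h σ 0) := by
      funext r
      refine logOf_congr _ _ _ _ _ ?_ fun i hi => absurd (hC i) hi
      funext i j
      simp [seenOf, hC]
    rw [hconst, PMF.map_const, PMF.map_const]

/-- Inputs whose honest part has the sum `X`, if some participant is honest. -/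
noncomputable def honestInput (X : ZMod 2) (i : Fin n) : ZMod 2 :=
  open Classical in if hC : ∃ j, j ∉ C then (if i = hC.choose then X else 0) else 0

theorem sum_honestInput (x : Fin n → ZMod 2) :
    ∑ i ∈ Cᶜ, honestInput C (∑ i ∈ Cᶜ, x i) i = ∑ i ∈ Cᶜ, x i := by
  by_cases hC : ∃ j, j ∉ C
  · have := hC.choose_spec
    simp [honestInput, hC, this]
  · have : Cᶜ = ∅ := by
      push Not at hC
      ext i
      simp [hC]
    simp [this]

theorem parityRound_eq_honestInput (x : Fin n → ZMod 2) :
    parityRound C A c h σ x = parityRound C A c h σ (honestInput C (∑ i ∈ Cᶜ, x i)) :=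
  parityRound_congr _ _ _ _ _ (sum_honestInput C x).symm

/-- If the corrupt participants follow the protocol, then the outcome is the sum of the honest
inputs. -/
theorem outcome_of_passive (hA : A.Passive C) (x : Fin n → ZMod 2) (u : RoundLog n)
    (hu : u ∈ (parityRound C A c h σ x).support) : outcome u.2 = some (∑ i ∈ Cᶜ, x i) := by
  rw [parityRound_eq_map, PMF.mem_support_map_iff] at hu
  obtain ⟨r, hr, rfl⟩ := hu
  rw [PMF.mem_support_uniformOfFinset_iff, mem_sharings] at hr
  rw [logOf, broadcast_eq_map, List.nil_append, outcome_map_some, List.map_ofFn, List.sum_ofFn]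
  · congr 1
    simp only [Function.comp_apply]
    rw [Equiv.sum_comp σ fun i => ∑ j, sentOf C A c h r j i, Finset.sum_comm,
      ← Finset.sum_add_sum_compl C, Finset.sum_eq_zero, zero_add]
    · refine Finset.sum_congr rfl fun i hi => ?_
      rw [← hr i]
      simp [sentOf, Finset.mem_compl.1 hi]
    · intro i hi
      simpa [sentOf, hi] using hA.1 c h (seenOf C r) i hi
  · intro t i hi
    rw [hA.2 _ _ _ _ i hi]
    congr 1
    refine Finset.sum_congr rfl fun j _ => ?_
    by_cases hj : j ∈ C <;> simp [sentOf, seenOf, hj, hi]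

/-- The last speaker, if honest, has a decisive influence on the outcome. -/
theorem Pr_outcome_add_single {i₀ : Fin n} (hi₀ : i₀ ∉ C)
    (hσ : (List.ofFn σ).getLast? = some i₀) (x : Fin n → ZMod 2) (a : ZMod 2) :
    Pr (parityRound C A c h σ (x + Pi.single i₀ 1)) {u | outcome u.2 = some (a + 1)}
      = Pr (parityRound C A c h σ x) {u | outcome u.2 = some a} := by
  obtain ⟨L, hL⟩ := List.getLast?_eq_some_iff.1 hσ
  have hnd : (L ++ [i₀]).Nodup := hL ▸ List.nodup_ofFn.2 σ.injective
  have hi₀L : i₀ ∉ L := by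
    rw [List.nodup_append] at hnd
    exact fun hm => hnd.2.2 i₀ hm i₀ (by simp) rfl
  -- The bijection changes only the bit that `i₀` keeps for itself. Everything before the last
  -- announcement stays the same, and that announcement is flipped.
  rw [parityRound_eq_map, parityRound_eq_map,
    ← uniformOfFinset_map_of_bijOn (sharings_nonempty x) (sharings_nonempty _) _
      (bijOn_sharings x (Pi.single i₀ 1) i₀), PMF.map_comp, Pr_map, Pr_map]
  congr 1
  ext r
  set r' : ShareMatrix n := fun i j => r i j + if j = i₀ then (Pi.single i₀ 1 : Fin n → ZMod 2) i else 0
    with hr'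
  have hs : seenOf C r' = seenOf C r := by
    funext i j
    unfold seenOf
    split_ifs with hij
    · rw [hr']
      dsimp only
      rw [if_neg, add_zero]
      rintro rfl
      exact hi₀ hij.2
    · rfl
  have hne : ∀ i ∈ L, i ∉ C → ∑ j, sentOf C A c h r' j i = ∑ j, sentOf C A c h r j i := by
    intro i hi _
    refine sum_sentOf_congr C A c h hs i (Finset.sum_congr rfl fun j _ => ?_)
    have : i ≠ i₀ := fun he => hi₀L (he ▸ hi)
    simp [hr', this]
  have heq : ∑ j, sentOf C A c h r' j i₀ = ∑ j, sentOf C A c h r j i₀ + 1 := by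
    rw [← Finset.sum_add_sum_compl C,
      ← Finset.sum_add_sum_compl C (fun j => sentOf C A c h r j i₀), add_assoc]
    congr 1
    · refine Finset.sum_congr rfl fun j hj => ?_
      simp [sentOf, hj, hs]
    · have : ∀ q, ∑ j ∈ Cᶜ, sentOf C A c h q j i₀ = ∑ j ∈ Cᶜ, q j i₀ := fun q =>
        Finset.sum_congr rfl fun j hj => by simp [sentOf, Finset.mem_compl.1 hj]
      rw [this, this]
      simp [hr', Finset.sum_add_distrib, Finset.sum_pi_single', hi₀]
  change outcome (logOf C A c h σ r').2 = _ ↔ outcome (logOf C A c h σ r).2 = _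
  rw [logOf, logOf, hs, hL, broadcast_append, broadcast_append, broadcast_congr C _ L _ hne]
  simp only [broadcast, if_neg hi₀, outcome_append_some, heq]
  cases outcome (broadcast C (fun i => ∑ j, sentOf C A c h r j i) (A.announce c h (seenOf C r)) L [])
    <;> simp [← add_assoc]

/-- The law of the sum of the honest inputs in a round of the veto: a uniform bit if some honest
participant wants to veto, and `0` otherwise. -/
noncomputable def vetoBit : Bool → PMF (ZMod 2)
  | true => PMF.uniformOfFintype (ZMod 2)
  | false => PMF.pure 0

/-- The fresh bit of a single vetoing honest participant makes the sum uniform, whatever the other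
bits are. -/
theorem uniform_bind_vetoBit {β : Type} (v : Fin n → Bool) (g : ZMod 2 → PMF β) :
    (PMF.uniformOfFintype (Fin n → ZMod 2)).bind
        (fun q => g (∑ i ∈ Cᶜ, if v i then q i else 0))
      = (vetoBit (decide (∃ i, i ∉ C ∧ v i = true))).bind g := by
  by_cases hv : ∃ i, i ∉ C ∧ v i = true
  · rw [decide_eq_true hv, vetoBit]
    obtain ⟨i, hi, hvi⟩ := hv
    rw [uniform_bind_update i]
    have key : ∀ (q : Fin n → ZMod 2) (a : ZMod 2),
        ∑ j ∈ Cᶜ, (if v j then Function.update q i a j else 0)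
          = a + ∑ j ∈ Cᶜ.erase i, if v j then q j else 0 := by
      intro q a
      rw [← Finset.add_sum_erase _ _ (Finset.mem_compl.2 hi)]
      simp only [hvi, if_true, Function.update_self]
      congr 1
      refine Finset.sum_congr rfl fun j hj => ?_
      rw [Function.update_of_ne (Finset.ne_of_mem_erase hj)]
    simp_rw [key, uniform_bind_add_right]
    exact bind_const' _ _
  · rw [decide_eq_false hv, vetoBit, PMF.pure_bind]
    push Not at hv
    have : ∀ q : Fin n → ZMod 2, (∑ i ∈ Cᶜ, if v i then q i else 0) = 0 := fun q =>
      Finset.sum_eq_zero fun i hi => by simp [hv i (Finset.mem_compl.1 hi)]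
    simp_rw [this]
    exact bind_const' _ _

/-- A round with a random honest input and an honest last speaker has outcome `1` or is interrupted
with probability at least one half. -/
theorem Pr_outcome_zero_le {i₀ : Fin n} (hi₀ : i₀ ∉ C)
    (hσ : (List.ofFn σ).getLast? = some i₀) :
    Pr ((vetoBit true).bind fun X => parityRound C A c h σ (honestInput C X))
      {u | outcome u.2 = some 0} ≤ 2⁻¹ := by
  have hX : ∀ X, parityRound C A c h σ (honestInput C X)
      = parityRound C A c h σ (Pi.single i₀ X) := by
    intro X
    rw [parityRound_eq_honestInput C A c h σ (Pi.single i₀ X)]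
    congr 2
    simp [Finset.sum_pi_single', hi₀]
  -- Outcome 0 on input 0 is as likely as outcome 1 on input 1. So the two probabilities to be
  -- averaged are those of disjoint events in the round with input 1, and they add up to at most 1.
  have h1 := Pr_outcome_add_single C A c h σ hi₀ hσ (Pi.single i₀ 1) 1
  rw [← Pi.single_add, show (1 + 1 : ZMod 2) = 0 from rfl] at h1
  simp_rw [hX]
  rw [Pr_bind, tsum_fintype, show (Finset.univ : Finset (ZMod 2)) = {0, 1} from rfl,
    Finset.sum_pair (by decide), h1, vetoBit]
  simp only [PMF.uniformOfFintype_apply, ZMod.card]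
  rw [← mul_add]
  refine mul_le_of_le_one_right' ?_
  calc _ = Pr (parityRound C A c h σ (Pi.single i₀ 1)) ({u | outcome u.2 = some 1} ∪ {u | outcome u.2 = some 0}) := by
        simp only [Pr, PMF.toOuterMeasure_apply]
        rw [← ENNReal.tsum_add]
        refine tsum_congr fun u => ?_
        rw [Set.indicator_union_of_disjoint]
        rw [Set.disjoint_left]
        intro u hu hu'
        simp only [Set.mem_ofPred_eq] at hu hu'
        rw [hu] at hu'
        exact absurd hu' (by decide)
    _ ≤ 1 := Pr_le_one _ _

end Round

/-! ### Sequences of rounds: the message phase and the veto -/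

section Phases

variable {n m ℓ s : ℕ} (C : Finset (Fin n)) (A : Adversary n) (c : A.Coin)

theorem PMF_foldlM_cons {σ ι : Type} (f : σ → ι → PMF σ) (b : σ) (a : ι) (L : List ι) :
    (a :: L).foldlM f b = (f b a).bind fun b' => L.foldlM f b' :=
  rfl

/-- Input words whose honest part has the sum `u`, if some participant is honest. -/
noncomputable def honestWord (u : Word ℓ) (i : Fin n) : Word ℓ := fun t => honestInput C (u t) i

/-- The message rounds depend on the inputs of the honest participants only through their sum. -/
theorem messagePhase_eq_honestWord (ord : Fin ℓ → Equiv.Perm (Fin n)) (x : Fin n → Word ℓ) :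
    messagePhase C A c ord x = messagePhase C A c ord (honestWord C (∑ i ∈ Cᶜ, x i)) := by
  unfold messagePhase
  congr 1
  funext st t
  cases st.2 with
  | none => rfl
  | some d =>
    dsimp only
    rw [parityRound_eq_honestInput]
    unfold honestWord
    rw [Finset.sum_apply]

/-- Whether some participant refused to broadcast. -/
def interrupted (h : List (RoundLog n)) : Bool := h.any fun v => (outcome v.2).isNone

/-- The second stage of the simulator receives only the log, and must recognise an interruption from
it. -/
theorem isNone_messagePhase (ord : Fin ℓ → Equiv.Perm (Fin n)) (x : Fin n → Word ℓ)
    (p : List (RoundLog n) × Option (Word ℓ)) (hp : p ∈ (messagePhase C A c ord x).support) :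
    p.2.isNone = interrupted p.1 := by
  have key : ∀ (f : List (RoundLog n) × Option (Word ℓ) → Fin ℓ →
        PMF (List (RoundLog n) × Option (Word ℓ)))
      (_ : ∀ st t, st.2.isNone = interrupted st.1 → ∀ q ∈ (f st t).support,
        q.2.isNone = interrupted q.1)
      (L : List (Fin ℓ)) (st) (_ : st.2.isNone = interrupted st.1),
      ∀ q ∈ (L.foldlM f st).support, q.2.isNone = interrupted q.1 := by
    intro f hf L
    induction L with
    | nil =>
      intro st hst q hq
      rw [show q = st by simpa [pure] using hq]
      exact hst
    | cons t L ih =>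
      intro st hst q hq
      rw [PMF_foldlM_cons, PMF.mem_support_bind_iff] at hq
      obtain ⟨st', hst', hq⟩ := hq
      exact ih st' (hf st t hst st' hst') q hq
  refine key _ ?_ _ _ rfl p hp
  intro st t hst q hq
  rcases hd : st.2 with _ | d
  · rw [hd] at hq
    rw [show q = st by simpa using hq]
    exact hst
  · rw [hd] at hq hst
    obtain ⟨v, -, rfl⟩ := (PMF.mem_support_map_iff _ _ _).1 hq
    simp only [interrupted, List.any_append] at hst ⊢
    rw [← hst]
    simp

/-- If the corrupt participants follow the protocol, then the outcomes of the message rounds are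
the sums of the honest inputs. -/
theorem messagePhase_of_passive (hA : A.Passive C) (ord : Fin ℓ → Equiv.Perm (Fin n))
    (x : Fin n → Word ℓ) (p : List (RoundLog n) × Option (Word ℓ))
    (hp : p ∈ (messagePhase C A c ord x).support) : p.2 = some (∑ i ∈ Cᶜ, x i) := by
  -- The invariant of the fold: coordinates already treated carry the honest sums, the others keep
  -- their initial value.
  have key : ∀ (f : List (RoundLog n) × Option (Word ℓ) → Fin ℓ →
        PMF (List (RoundLog n) × Option (Word ℓ)))
      (_ : ∀ st t d, st.2 = some d → ∀ q ∈ (f st t).support,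
        q.2 = some (Function.update d t (∑ i ∈ Cᶜ, x i t)))
      (L : List (Fin ℓ)) (st) (d) (_ : st.2 = some d),
      ∀ q ∈ (L.foldlM f st).support, ∃ d', q.2 = some d' ∧ (∀ t ∉ L, d' t = d t) ∧
        ∀ t ∈ L, d' t = ∑ i ∈ Cᶜ, x i t := by
    intro f hf L
    induction L with
    | nil =>
      intro st d hst q hq
      rw [show q = st by simpa [pure] using hq]
      exact ⟨d, hst, by simp, by simp⟩
    | cons t L ih =>
      intro st d hst q hq
      rw [PMF_foldlM_cons, PMF.mem_support_bind_iff] at hq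
      obtain ⟨st', hst', hq⟩ := hq
      obtain ⟨d', hd', h1, h2⟩ := ih st' _ (hf st t d hst st' hst') q hq
      refine ⟨d', hd', fun t' ht' => ?_, fun t' ht' => ?_⟩
      · rw [List.mem_cons, not_or] at ht'
        rw [h1 t' ht'.2, Function.update_of_ne ht'.1]
      · by_cases hL : t' ∈ L
        · exact h2 t' hL
        · obtain rfl : t' = t := (List.mem_cons.1 ht').resolve_right hL
          rw [h1 t' hL, Function.update_self]
  have hk : ∃ d', p.2 = some d' ∧ (∀ t ∉ List.finRange ℓ, d' t = (0 : Word ℓ) t) ∧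
      ∀ t ∈ List.finRange ℓ, d' t = ∑ i ∈ Cᶜ, x i t := by
    refine key _ ?_ _ _ 0 rfl p hp
    intro st t d hd q hq
    rw [hd] at hq
    obtain ⟨v, hv, rfl⟩ := (PMF.mem_support_map_iff _ _ _).1 hq
    simp [outcome_of_passive C A c _ _ hA _ v hv]
  obtain ⟨d', hd', -, h2⟩ := hk
  rw [hd']
  congr 1
  funext t
  rw [h2 t (List.mem_finRange t), Finset.sum_apply]

/-- One round of the veto, where `b` says whether some honest participant wants to veto. -/
noncomputable def vetoRound (h : List (RoundLog n)) (b : Bool) (st : List (RoundLog n) × Bool)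
    (σ : Equiv.Perm (Fin n)) : PMF (List (RoundLog n) × Bool) :=
  ((vetoBit b).bind fun X => parityRound C A c (h ++ st.1) σ (honestInput C X)).map fun u =>
    (st.1 ++ [u], st.2 || decide (outcome u.2 ≠ some 0))

theorem vetoPhase_eq_foldlM (h : List (RoundLog n)) (ord : Fin n → Equiv.Perm (Fin n))
    (v : Fin n → Bool) :
    vetoPhase s C A c h ord v = ((List.finRange n).flatMap fun k => List.replicate s (ord k)).foldlM
      (vetoRound C A c h (decide (∃ i, i ∉ C ∧ v i = true))) ([], false) := by
  unfold vetoPhase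
  congr 1
  funext st σ
  rw [vetoRound, ← uniform_bind_vetoBit C v, PMF.map_bind]
  congr 1
  funext q
  rw [parityRound_eq_honestInput]

theorem vetoPhase_congr (h : List (RoundLog n)) (ord : Fin n → Equiv.Perm (Fin n))
    {v v' : Fin n → Bool} (hv : (∃ i, i ∉ C ∧ v i = true) ↔ ∃ i, i ∉ C ∧ v' i = true) :
    vetoPhase s C A c h ord v = vetoPhase s C A c h ord v' := by
  rw [vetoPhase_eq_foldlM, vetoPhase_eq_foldlM, decide_eq_decide.2 hv]

/-- A raised veto flag stays raised. Otherwise each round that ends with `i₀` contributes a factor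
of one half, conditionally on the past; other rounds are bounded by 1. -/
theorem Pr_foldlM_vetoRound_le (h : List (RoundLog n)) (L : List (Equiv.Perm (Fin n)))
    {i₀ : Fin n} (hi₀ : i₀ ∉ C) (st : List (RoundLog n) × Bool) :
    Pr (L.foldlM (vetoRound C A c h true) st) {q | q.2 = false}
      ≤ if st.2 then 0 else (2⁻¹ : ℝ≥0∞) ^ L.countP fun σ : Equiv.Perm (Fin n) => (List.ofFn σ).getLast? = some i₀ := by
  induction L generalizing st with
  | nil =>
    rw [List.foldlM_nil]
    classical
    change Pr (PMF.pure st) _ ≤ _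
    obtain ⟨h', b⟩ := st
    cases b <;> simp [Pr_pure]
  | cons σ L ih =>
    rw [PMF_foldlM_cons]
    set k := L.countP fun σ : Equiv.Perm (Fin n) => (List.ofFn σ).getLast? = some i₀
    refine (Pr_bind_le_mul _ _ _ {q | q.2 = false} ((2⁻¹ : ℝ≥0∞) ^ k) ?_ ?_).trans ?_
    · intro q hq
      have := ih q
      rwa [show q.2 = false from hq, if_neg (by simp)] at this
    · intro q hq
      have := ih q
      rw [show q.2 = true by simpa using hq, if_pos rfl] at this
      exact le_antisymm this zero_le
    · rw [vetoRound, Pr_map]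
      cases h2 : st.2 with
      | true => simp [Pr]
      | false =>
        rw [if_neg (by simp), List.countP_cons]
        split_ifs with hσ
        · rw [pow_succ']
          gcongr
          have := Pr_outcome_zero_le C A c (h ++ st.1) σ hi₀ (by simpa using hσ)
          simpa using this
        · simpa using mul_le_of_le_one_left' (Pr_le_one _ _)

/-- A veto is noticed, except with a small probability. -/
theorem Pr_vetoPhase_le (sch : Schedule n ℓ) (h : List (RoundLog n)) (v : Fin n → Bool)
    (hv : ∃ i, i ∉ C ∧ v i = true) :
    Pr (vetoPhase s C A c h sch.veto v) {q | q.2 = false} ≤ (2⁻¹ : ℝ≥0∞) ^ s := by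
  rw [vetoPhase_eq_foldlM, decide_eq_true hv]
  obtain ⟨i₀, hi₀, -⟩ := hv
  have hn : 0 < n := i₀.pos
  have hlast : ∀ k, ∃ i, (List.ofFn (sch.veto k)).getLast? = some i := by
    intro k
    refine ⟨_, List.getLast?_eq_some_getLast ?_⟩
    rw [Ne, List.ofFn_eq_nil_iff]
    omega
  choose g hg using hlast
  have hinj : Function.Injective g := fun k k' hk =>
    sch.veto_last (by simp only [hg, hk])
  -- There are as many orderings as participants and the last speakers differ, so `i₀` is last in
  -- some ordering, which is used for `s` rounds.
  obtain ⟨k, hk⟩ := (Finite.injective_iff_surjective.1 hinj) i₀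
  refine (Pr_foldlM_vetoRound_le C A c h _ hi₀ _).trans ?_
  rw [if_neg (by simp)]
  refine pow_le_pow_right_of_le_one' (by simp) ?_
  have hsub : List.Sublist (List.replicate s (sch.veto k))
      ((List.finRange n).flatMap fun k => List.replicate s (sch.veto k)) := by
    rw [List.flatMap_def]
    exact List.sublist_flatten_of_mem (List.mem_map.2 ⟨k, List.mem_finRange k, rfl⟩)
  refine le_trans ?_ hsub.countP_le
  simp [List.countP_replicate, hg, hk]

end Phases

/-! ### The AMD code: polynomial tags over a field of characteristic 2 -/

section Code

open Polynomial

/-- The authentication tag of the message `a` with the key `e`. -/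
def tag {K : Type} [Field K] (N : ℕ) (a : Fin (N - 1) → K) (e : K) : K :=
  e ^ (N + 1) + ∑ i, a i * e ^ (i.val + 1)

/-- The part of the tag that depends on the message, as a polynomial in the key. -/
noncomputable def messagePoly {K : Type} [Field K] (N : ℕ) (a : Fin (N - 1) → K) : K[X] :=
  ∑ i, C (a i) * X ^ (i.val + 1)

variable {K : Type} [Field K] {N : ℕ}

theorem natDegree_messagePoly_le (a : Fin (N - 1) → K) : (messagePoly N a).natDegree ≤ N - 1 :=
  natDegree_sum_le_of_forall_le _ _ fun i _ => (natDegree_C_mul_X_pow_le _ _).trans i.isLt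

theorem coeff_messagePoly_succ (a : Fin (N - 1) → K) (i : Fin (N - 1)) :
    (messagePoly N a).coeff (i + 1) = a i := by
  simp [messagePoly, coeff_X_pow, Fin.val_inj]

theorem coeff_messagePoly_zero (a : Fin (N - 1) → K) : (messagePoly N a).coeff 0 = 0 := by
  simp [messagePoly]

theorem tag_eq (a : Fin (N - 1) → K) (e : K) :
    tag N a e = e ^ (N + 1) + (messagePoly N a).eval e := by
  simp [tag, messagePoly, eval_finsetSum]

/-- The polynomial whose roots are the keys for which a manipulation is not detected. -/
noncomputable def manipulationPoly (N : ℕ) (a a' : Fin (N - 1) → K) (δ τ : K) : K[X] :=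
  C δ * X ^ N + (C (δ ^ N) * X + C (δ ^ (N + 1)) + (messagePoly N a').comp (X + C δ)
    - messagePoly N a - C τ)

/-- Hence `δ` is the coefficient of `X ^ N` in `manipulationPoly`. The linear term is the reason for
`2 ≤ N`. -/
theorem natDegree_manipulationPoly_le (hN : 2 ≤ N) (a a' : Fin (N - 1) → K) (δ τ : K) :
    (C (δ ^ N) * X + C (δ ^ (N + 1)) + (messagePoly N a').comp (X + C δ)
      - messagePoly N a - C τ).natDegree ≤ N - 1 := by
  refine natDegree_le_iff_degree_le.2 ?_
  refine (degree_sub_le_of_le (degree_sub_le_of_le (degree_add_le_of_le (degree_add_le_of_le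
    (b := (N - 1 : ℕ)) (a := (N - 1 : ℕ)) ?_ ?_) (b := (N - 1 : ℕ)) ?_) (b := (N - 1 : ℕ)) ?_)
    (b := (N - 1 : ℕ)) ?_).trans (by simp) <;> rw [← natDegree_le_iff_degree_le]
  · exact (natDegree_C_mul_le _ _).trans (natDegree_X_le.trans (by omega))
  · simp
  · rw [natDegree_comp, natDegree_X_add_C, mul_one]
    exact natDegree_messagePoly_le a'
  · exact natDegree_messagePoly_le a
  · simp

/-- If the polynomial vanishes, its leading coefficient gives `δ = 0`. Then `messagePoly` having no
constant term gives `τ = 0`, and the remaining coefficients give `a = a'`. -/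
theorem manipulationPoly_ne_zero (hN : 2 ≤ N) {a a' : Fin (N - 1) → K} {δ τ : K}
    (h : ¬ (a = a' ∧ δ = 0 ∧ τ = 0)) : manipulationPoly N a a' δ τ ≠ 0 := by
  intro h0
  have hδ : δ = 0 := by
    have := congrArg (coeff · N) h0
    rw [manipulationPoly, coeff_add, coeff_eq_zero_of_natDegree_lt (n := N)
      ((natDegree_manipulationPoly_le hN a a' δ τ).trans_lt (by omega))] at this
    simpa using this
  subst hδ
  have h1 : messagePoly N a' - messagePoly N a - C τ = 0 := by
    have hN0 : N ≠ 0 := by omega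
    simpa [manipulationPoly, hN0] using h0
  have hτ : τ = 0 := by
    have := congrArg (coeff · 0) h1
    simpa [coeff_messagePoly_zero] using this
  refine h ⟨?_, rfl, hτ⟩
  funext i
  have := congrArg (coeff · (i + 1)) h1
  simp only [coeff_sub, coeff_messagePoly_succ, hτ, map_zero, coeff_zero, sub_zero] at this
  exact (sub_eq_zero.1 this).symm

/-- Frobenius gives `(e + δ) ^ N = e ^ N + δ ^ N` for `N = 2 ^ t`, so the terms `e ^ (N + 1)` cancel
and `δ * e ^ N` remains. The message part of the tag stays below the exponent `N`, so nothing can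
compensate this term. -/
theorem eval_manipulationPoly [CharP K 2] {t : ℕ} (a a' : Fin (2 ^ t - 1) → K) (δ τ e : K) :
    (manipulationPoly (2 ^ t) a a' δ τ).eval e
      = tag (2 ^ t) a' (e + δ) - (tag (2 ^ t) a e + τ) := by
  rw [tag_eq, tag_eq, pow_succ (e + δ), add_pow_char_pow]
  simp only [manipulationPoly, eval_add, eval_sub, eval_mul, eval_C, eval_pow, eval_X, eval_comp]
  ring

/-- A manipulation of message, key and tag is not detected for at most `N` keys. -/
theorem card_tag_le [CharP K 2] [Fintype K] [DecidableEq K] {t : ℕ} (ht : 1 ≤ t)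
    {a a' : Fin (2 ^ t - 1) → K} {δ τ : K} (h : ¬ (a = a' ∧ δ = 0 ∧ τ = 0)) :
    (Finset.univ.filter fun e => tag (2 ^ t) a' (e + δ) = tag (2 ^ t) a e + τ).card ≤ 2 ^ t := by
  have hN : 2 ≤ 2 ^ t := by simpa using Nat.pow_le_pow_right (n := 2) (by norm_num) ht
  have h0 := manipulationPoly_ne_zero hN h
  calc _ ≤ (manipulationPoly (2 ^ t) a a' δ τ).roots.toFinset.card := by
        refine Finset.card_le_card fun e he => ?_
        rw [Multiset.mem_toFinset, mem_roots h0, IsRoot, eval_manipulationPoly, sub_eq_zero]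
        exact (Finset.mem_filter.1 he).2
    _ ≤ (manipulationPoly (2 ^ t) a a' δ τ).roots.card := Multiset.toFinset_card_le _
    _ ≤ _ := card_roots' _
    _ ≤ 2 ^ t := by
        refine natDegree_add_le_of_degree_le (natDegree_C_mul_X_pow_le _ _) ?_
        exact (natDegree_manipulationPoly_le hN a a' δ τ).trans (Nat.sub_le _ _)

theorem exists_amdCode (m s : ℕ) (hm : 2 ≤ m) :
    Nonempty (AMDCode m (m + 2 * (Nat.clog 2 m + s)) s) := by
  classical
  obtain ⟨t, ht⟩ : ∃ t, t = Nat.clog 2 m := ⟨_, rfl⟩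
  obtain ⟨κ, hκ⟩ : ∃ κ, κ = t + s := ⟨_, rfl⟩
  rw [← ht, ← hκ]
  have ht1 : 1 ≤ t := ht ▸ Nat.clog_pos (by norm_num) hm
  have hmt : m ≤ 2 ^ t := ht ▸ Nat.le_pow_clog (by norm_num) m
  have hκ0 : κ ≠ 0 := by omega
  let K := GaloisField 2 κ
  have : Fintype K := Fintype.ofFinite K
  have hfin : Module.finrank (ZMod 2) K = κ := GaloisField.finrank 2 hκ0
  let φ : Word κ ≃ₗ[ZMod 2] K := LinearEquiv.ofFinrankEq _ _ (by simp [hfin])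
  let ψ : Word (m + 2 * κ) ≃ₗ[ZMod 2] Word m × Word κ × Word κ :=
    LinearEquiv.ofFinrankEq _ _ (by simp; ring)
  -- For `s = 0` the space of coefficients may be too small for an injection, but then the error
  -- bound is 1 and `L = 0` suffices, since the codeword contains the message itself.
  obtain ⟨L, hL⟩ : ∃ L : Word m →ₗ[ZMod 2] (Fin (2 ^ t - 1) → K),
      s ≠ 0 → Function.Injective L := by
    by_cases hs : s = 0
    · exact ⟨0, fun h => absurd hs h⟩
    · obtain ⟨L, hL⟩ : ∃ L : Word m →ₗ[ZMod 2] (Fin (2 ^ t - 1) → K), Function.Injective L := by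
        refine finrank_le_iff_exists_linearMap.mp ?_
        have hdim : Module.finrank (ZMod 2) (Fin (2 ^ t - 1) → K) = (2 ^ t - 1) * κ := by
          simp [Module.finrank_pi_fintype, hfin]
        rw [hdim, Module.finrank_fintype_fun_eq_card, Fintype.card_fin]
        -- Here `κ = t + s ≥ 2`, and `2 * (2 ^ t - 1) ≥ 2 ^ t ≥ m` since `t ≥ 1`.
        have : (2 ^ t - 1) * 2 ≤ (2 ^ t - 1) * κ := Nat.mul_le_mul_left _ (by omega)
        omega
      exact ⟨L, fun _ => hL⟩
  -- A codeword consists of the message, the key and the tag; `ψ` packs them into `m + 2 * κ` bits.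
  refine ⟨⟨κ, fun w e => ψ.symm (w, e, φ.symm (tag (2 ^ t) (L w) (φ e))), fun x =>
    if tag (2 ^ t) (L (ψ x).1) (φ (ψ x).2.1) = φ (ψ x).2.2 then some (ψ x).1 else none,
    fun w e => by simp, fun w δ hδ => ?_⟩⟩
  by_cases hs : s = 0
  · subst hs
    simpa using Pr_le_one _ _
  have hne : ¬ (L w = L (w + (ψ δ).1) ∧ φ (ψ δ).2.1 = 0 ∧ φ (ψ δ).2.2 = 0) := by
    rintro ⟨h1, h2, h3⟩
    refine hδ (ψ.injective ?_)
    have h1' := hL hs h1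
    rw [map_zero]
    ext1
    · simpa using h1'
    · ext1
      · simpa using h2
      · simpa using h3
  have hcard := card_tag_le ht1 hne
  rw [Pr_uniform]
  have hc : (Finset.univ.filter (· ∈ {e : Word κ | (if tag (2 ^ t)
      (L (ψ (ψ.symm (w, e, φ.symm (tag (2 ^ t) (L w) (φ e))) + δ)).1)
      (φ (ψ (ψ.symm (w, e, φ.symm (tag (2 ^ t) (L w) (φ e))) + δ)).2.1)
      = φ (ψ (ψ.symm (w, e, φ.symm (tag (2 ^ t) (L w) (φ e))) + δ)).2.2
      then some (ψ (ψ.symm (w, e, φ.symm (tag (2 ^ t) (L w) (φ e))) + δ)).1 else none)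
      ≠ none})).card ≤ 2 ^ t := by
    refine le_trans (Finset.card_le_card_of_injOn φ (fun e he => ?_) φ.injective.injOn) hcard
    simpa using he
  have hκc : Fintype.card (Word κ) = 2 ^ (t + s) := by simp [hκ]
  rw [hκc]
  calc _ ≤ ((2 ^ t : ℕ) : ℝ≥0∞) / ((2 ^ (t + s) : ℕ) : ℝ≥0∞) := by
        gcongr
    _ = 2⁻¹ ^ s := by
        push_cast
        rw [pow_add, ← ENNReal.inv_pow]
        rw [ENNReal.div_eq_inv_mul, ENNReal.mul_inv (by simp) (by simp), mul_right_comm,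
          ENNReal.inv_mul_cancel (by simp) (by simp), one_mul]

end Code

/-! ### Unpredictability of codewords -/

section CodeProbabilities

variable {m ℓ s : ℕ} (F : AMDCode m ℓ s)

theorem Word_add_self {k : ℕ} (u : Word k) : u + u = 0 := by
  funext i
  exact CharTwo.add_self_eq_zero _

theorem Word_add_eq_zero {k : ℕ} {u v : Word k} : u + v = 0 ↔ u = v := by
  rw [← Word_add_self v, add_left_inj]

/-- A predictable codeword could be replaced by an encoding of another message `w'`: adding `a +
F.encode w' 0` turns `a` into a valid word. If this manipulation is zero, then `a` decodes to `w'`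
and never encodes `w`. -/
theorem Pr_encode_eq_le (hm : 1 ≤ m) (w : Word m) (a : Word ℓ) :
    Pr (PMF.uniformOfFintype (Word F.coins)) {e | F.encode w e = a} ≤ (2⁻¹ : ℝ≥0∞) ^ s := by
  obtain ⟨w', hw'⟩ : ∃ w' : Word m, w' ≠ w := by
    have : Nonempty (Fin m) := ⟨⟨0, hm⟩⟩
    exact exists_ne w
  by_cases ha : a = F.encode w' 0
  · have : {e | F.encode w e = a} = ∅ := by
      ext e
      simp only [Set.mem_ofPred_eq, Set.mem_empty_iff_false, iff_false, ha]
      intro h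
      have := F.decode_encode w e
      rw [h, F.decode_encode] at this
      exact hw' (Option.some.inj this)
    simp [this, Pr]
  · refine le_trans (Pr_mono _ ?_) (F.detect w (a + F.encode w' 0) (by rwa [Ne, Word_add_eq_zero]))
    rintro e rfl
    rw [Set.mem_ofPred_eq, ← add_assoc, Word_add_self, zero_add, F.decode_encode]
    simp

/-- A uniform word has the law of a uniform `z` plus an encoding of `0`, so `d + z` acts as a
manipulation of that encoding. One error term pays for `d + z = 0`, the other for an undetected
nonzero manipulation. -/
theorem Pr_uniform_decode_le (hm : 1 ≤ m) (d : Word ℓ) :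
    Pr (PMF.uniformOfFintype (Word ℓ)) {z | F.decode (d + z) ≠ none} ≤ 2 * (2⁻¹ : ℝ≥0∞) ^ s := by
  have key : ∀ E : Set (Word ℓ), Pr (PMF.uniformOfFintype (Word ℓ)) E
      = Pr ((PMF.uniformOfFintype (Word ℓ)).bind fun z =>
          (PMF.uniformOfFintype (Word F.coins)).map fun e => z + F.encode 0 e) E := by
    intro E
    congr 1
    simp only [← PMF.bind_pure_comp]
    rw [PMF.bind_comm]
    simp only [Function.comp_def, uniform_bind_add_right _ PMF.pure]
    simp
  have h0 : Pr (PMF.uniformOfFintype (Word ℓ)) {z | d + z = 0} ≤ (2⁻¹ : ℝ≥0∞) ^ s := by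
    rw [key]
    refine Pr_bind_le _ _ _ _ fun z => ?_
    rw [Pr_map]
    refine le_trans (Pr_mono _ ?_) (Pr_encode_eq_le F hm 0 (d + z))
    intro e he
    rw [Set.mem_preimage, Set.mem_ofPred_eq, ← add_assoc, Word_add_eq_zero] at he
    exact he.symm
  rw [key, two_mul]
  refine (Pr_bind_le_add _ _ _ {z | d + z = 0} _ fun z hz => ?_).trans (add_le_add_left h0 _)
  rw [Pr_map]
  refine le_trans (Pr_mono _ ?_) (F.detect 0 (d + z) hz)
  intro e he
  rwa [Set.mem_preimage, Set.mem_ofPred_eq, ← add_assoc, add_comm] at he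

end CodeProbabilities

/-! ### Reduction to the sum of the honest inputs, and correctness -/

section Protocol

variable {n m ℓ s : ℕ} (F : AMDCode m ℓ s) (sch : Schedule n ℓ) (C : Finset (Fin n))
  (A : Adversary n) (roles : Roles n m) (c : A.Coin)

/-- The message rounds when the inputs of the honest participants have the sum `u`. -/
noncomputable def messageRounds (u : Word ℓ) : PMF (List (RoundLog n) × Option (Word ℓ)) :=
  messagePhase C A c sch.parity (honestWord C u)

/-- The remainder of the protocol after the message rounds, where `ρ` are the masks. -/
noncomputable def completion (ρ : Fin n → Word ℓ) (p : List (RoundLog n) × Option (Word ℓ)) :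
    PMF (Execution A m) :=
  match p.2 with
  | none => PMF.pure ⟨(c, p.1, []), true, fun _ => none⟩
  | some d =>
    (vetoPhase s C A c p.1 sch.veto fun i =>
      decide (i ∈ roles.recv) && (F.decode (d + ρ i)).isNone).map
        fun q => ⟨(c, p.1, q.1), q.2, fun i => F.decode (d + ρ i)⟩

theorem fixedRoleAMT_eq : fixedRoleAMT F sch C A roles = A.coin.bind fun c =>
    (PMF.uniformOfFintype (Fin n → Word F.coins)).bind fun e =>
    (PMF.uniformOfFintype (Fin n → Word ℓ)).bind fun ρ =>
    (messageRounds sch C A c (∑ i ∈ Cᶜ, inputWord F roles e ρ i)).bind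
      (completion F sch C A roles c ρ) := by
  unfold fixedRoleAMT
  refine bind_congr_fun _ fun c => ?_
  refine bind_congr_fun _ fun e => ?_
  refine bind_congr_fun _ fun ρ => ?_
  rw [messagePhase_eq_honestWord, ← messageRounds]
  exact bind_congr_fun _ fun p => rfl

theorem sum_inputWord_update_mask {R : Fin n} (hR : R ∉ C) (hRr : R ∈ roles.recv)
    (e : Fin n → Word F.coins) (ρ : Fin n → Word ℓ) (x : Word ℓ) :
    ∑ i ∈ Cᶜ, inputWord F roles e (Function.update ρ R x) i
      = x + ∑ i ∈ Cᶜ, inputWord F roles e (Function.update ρ R 0) i := by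
  rw [← Finset.add_sum_erase _ _ (Finset.mem_compl.2 hR),
    ← Finset.add_sum_erase _ _ (Finset.mem_compl.2 hR), ← add_assoc]
  congr 1
  · simp [inputWord, hRr, add_comm]
  · refine Finset.sum_congr rfl fun i hi => ?_
    simp [inputWord, Finset.ne_of_mem_erase hi]

theorem sum_inputWord_update_coins {S : Fin n} (hS : S ∉ C) {w : Word m}
    (hSw : roles.send S = some w) (e : Fin n → Word F.coins) (ρ : Fin n → Word ℓ)
    (a : Word F.coins) :
    ∑ i ∈ Cᶜ, inputWord F roles (Function.update e S a) ρ i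
      = F.encode w a + ((if S ∈ roles.recv then ρ S else 0)
        + ∑ i ∈ Cᶜ.erase S, inputWord F roles e ρ i) := by
  rw [← Finset.add_sum_erase _ _ (Finset.mem_compl.2 hS), ← add_assoc]
  congr 1
  · simp [inputWord, hSw]
  · refine Finset.sum_congr rfl fun i hi => ?_
    simp [inputWord, Finset.ne_of_mem_erase hi]

theorem sum_erase_inputWord_update_coins {S S' : Fin n} (hSS' : S ≠ S') (hS' : S' ∉ C) {w : Word m}
    (hSw : roles.send S' = some w) (e : Fin n → Word F.coins) (ρ : Fin n → Word ℓ)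
    (b : Word F.coins) :
    ∑ i ∈ Cᶜ.erase S, inputWord F roles (Function.update e S' b) ρ i
      = F.encode w b + ((if S' ∈ roles.recv then ρ S' else 0)
        + ∑ i ∈ (Cᶜ.erase S).erase S', inputWord F roles e ρ i) := by
  rw [← Finset.add_sum_erase _ _
    (Finset.mem_erase.2 ⟨hSS'.symm, Finset.mem_compl.2 hS'⟩), ← add_assoc]
  congr 1
  · simp [inputWord, hSw]
  · refine Finset.sum_congr rfl fun i hi => ?_
    simp [inputWord, Finset.ne_of_mem_erase hi]

theorem sum_inputWord_unique (S R : Fin n) (w : Word m) (e : Fin n → Word F.coins)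
    (ρ : Fin n → Word ℓ) :
    ∑ i ∈ Cᶜ, inputWord F (Roles.unique S R w) e ρ i
      = (if S ∈ C then 0 else F.encode w (e S)) + (if R ∈ C then 0 else ρ R) := by
  have h : ∀ i, inputWord F (Roles.unique S R w) e ρ i
      = (if i = S then F.encode w (e S) else 0) + if i = R then ρ R else 0 := by
    intro i
    by_cases hS : i = S <;> by_cases hR : i = R <;> simp [inputWord, Roles.unique, hS, hR] <;> aesop
  simp_rw [h, Finset.sum_add_distrib, Finset.sum_ite_eq', Finset.mem_compl, ite_not]

theorem Pr_completion_eq_zero (ρ : Fin n → Word ℓ) (p : List (RoundLog n) × Option (Word ℓ))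
    (R : Fin n) (Q : Option (Word m) → Prop) (h : ∀ d, p.2 = some d → ¬ Q (F.decode (d + ρ R))) :
    Pr (completion F sch C A roles c ρ p) {x | x.aborted = false ∧ Q (x.decoded R)} = 0 := by
  classical
  unfold completion
  rcases hp : p.2 with _ | d
  · simp [Pr_pure]
  · have := h d hp
    simp [this, Pr]

/-- A receiver that detects a manipulation makes the protocol abort. -/
theorem Pr_completion_le {R : Fin n} (hR : R ∉ C) (hRr : R ∈ roles.recv) (ρ : Fin n → Word ℓ)
    (p : List (RoundLog n) × Option (Word ℓ))
    (h : ∀ d, p.2 = some d → F.decode (d + ρ R) = none) :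
    Pr (completion F sch C A roles c ρ p) {x | x.aborted = false} ≤ (2⁻¹ : ℝ≥0∞) ^ s := by
  classical
  unfold completion
  rcases hp : p.2 with _ | d
  · simp [Pr_pure]
  · dsimp only
    rw [Pr_map]
    exact Pr_vetoPhase_le C A c sch p.1 _ ⟨R, hR, by simp [hRr, h d hp]⟩

/-- With one honest sender and one honest receiver, the sum of the honest inputs is uniform and
independent of the coins for the encoding. -/
theorem fixedRoleAMT_unique {S R : Fin n} (hS : S ∉ C) (hR : R ∉ C) (w : Word m) :
    fixedRoleAMT F sch C A (Roles.unique S R w) = A.coin.bind fun c =>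
      (PMF.uniformOfFintype (Fin n → Word ℓ)).bind fun g =>
      (PMF.uniformOfFintype (Word ℓ)).bind fun u =>
      (messageRounds sch C A c u).bind fun p =>
      (PMF.uniformOfFintype (Word F.coins)).bind fun e =>
      completion F sch C A (Roles.unique S R w) c (Function.update g R (u + F.encode w e)) p := by
  rw [fixedRoleAMT_eq]
  refine bind_congr_fun _ fun c => ?_
  simp_rw [sum_inputWord_unique, if_neg hS, if_neg hR]
  rw [uniform_bind_eval S fun e => (PMF.uniformOfFintype (Fin n → Word ℓ)).bind fun ρ =>
    (messageRounds sch C A c (F.encode w e + ρ R)).bind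
      (completion F sch C A (Roles.unique S R w) c ρ), PMF.bind_comm, uniform_bind_update R]
  refine bind_congr_fun _ fun g => ?_
  rw [PMF.bind_comm]
  -- Substitution of `u = F.encode w e + x` for the mask `x`: the message rounds then involve `u`
  -- only, and the coins `e` can be drawn after them.
  have h1 : ∀ e, ((PMF.uniformOfFintype (Word ℓ)).bind fun x =>
      (messageRounds sch C A c (F.encode w e + Function.update g R x R)).bind
        (completion F sch C A (Roles.unique S R w) c (Function.update g R x)))
      = (PMF.uniformOfFintype (Word ℓ)).bind fun u => (messageRounds sch C A c u).bind
        (completion F sch C A (Roles.unique S R w) c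
          (Function.update g R (u + F.encode w e))) := by
    intro e
    rw [← uniform_bind_add_right (F.encode w e)]
    refine bind_congr_fun _ fun u => ?_
    rw [Function.update_self, add_left_comm, Word_add_self, add_zero]
  refine (bind_congr_fun _ h1).trans ?_
  rw [PMF.bind_comm]
  refine bind_congr_fun _ fun u => ?_
  rw [PMF.bind_comm]

/-- The manipulation `d + u` is fixed before the coins of the encoding are drawn. -/
theorem Pr_manipulation_accepted_le (w : Word m) (u : Word ℓ)
    (p : List (RoundLog n) × Option (Word ℓ)) :
    Pr (PMF.uniformOfFintype (Word F.coins))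
      {e | ∃ d, p.2 = some d ∧ d ≠ u ∧ F.decode (d + (u + F.encode w e)) ≠ none}
        ≤ (2⁻¹ : ℝ≥0∞) ^ s := by
  rcases hp : p.2 with _ | d
  · simp [Pr]
  · by_cases hd : d = u
    · simp [hd, Pr]
    · refine le_trans (Pr_mono _ ?_) (F.detect w (d + u) (by rwa [Ne, Word_add_eq_zero]))
      rintro e ⟨d', hd', -, he⟩
      cases hd'
      rwa [Set.mem_ofPred_eq, add_comm, add_assoc]

/-- If `d = u`, the receiver decodes `w`. Otherwise it accepts with probability at most `2⁻¹ ^ s`,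
and if it rejects, its veto fails with at most the same probability; only the second bound has to
pay for this. -/
theorem correctness {S R : Fin n} (hS : S ∉ C) (hR : R ∉ C) (w : Word m) :
    Pr (fixedRoleAMT F sch C A (Roles.unique S R w))
        {x | x.aborted = false ∧ ∃ w', x.decoded R = some w' ∧ w' ≠ w} ≤ (2⁻¹ : ℝ≥0∞) ^ s ∧
      Pr (fixedRoleAMT F sch C A (Roles.unique S R w))
        {x | x.aborted = false ∧ x.decoded R ≠ some w} ≤ 2 * (2⁻¹ : ℝ≥0∞) ^ s := by
  have hok : ∀ (p : List (RoundLog n) × Option (Word ℓ)) (u : Word ℓ) (e : Word F.coins),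
      e ∉ {e | ∃ d, p.2 = some d ∧ d ≠ u ∧ F.decode (d + (u + F.encode w e)) ≠ none} →
      ∀ d, p.2 = some d → F.decode (d + (u + F.encode w e)) = none ∨
        (F.decode (d + (u + F.encode w e)) = some w ∧ d = u) := by
    intro p u e he d hd
    by_cases hdu : d = u
    · subst hdu
      rw [← add_assoc, Word_add_self, zero_add]
      exact Or.inr ⟨F.decode_encode w e, rfl⟩
    · refine Or.inl ?_
      by_contra hne
      exact he ⟨d, hd, hdu, hne⟩
  rw [fixedRoleAMT_unique F sch C A hS hR]
  refine ⟨Pr_bind_le _ _ _ _ fun c => Pr_bind_le _ _ _ _ fun g => Pr_bind_le _ _ _ _ fun u =>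
    Pr_bind_le _ _ _ _ fun p => ?_, Pr_bind_le _ _ _ _ fun c => Pr_bind_le _ _ _ _ fun g =>
    Pr_bind_le _ _ _ _ fun u => Pr_bind_le _ _ _ _ fun p => ?_⟩
  · rw [← add_zero ((2⁻¹ : ℝ≥0∞) ^ s)]
    refine (Pr_bind_le_add _ _ _ _ 0 fun e he => ?_).trans
      (add_le_add_left (Pr_manipulation_accepted_le F w u p) _)
    refine (Pr_completion_eq_zero F sch C A _ c _ p R (fun y => ∃ w', y = some w' ∧ w' ≠ w)
      fun d hd => ?_).le
    rw [Function.update_self]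
    rcases hok p u e he d hd with h | ⟨h, -⟩
    · simp [h]
    · simp [h]
  · rw [two_mul]
    refine (Pr_bind_le_add _ _ _ _ _ fun e he => ?_).trans
      (add_le_add_left (Pr_manipulation_accepted_le F w u p) _)
    by_cases hu : p.2 = some u
    · refine (Pr_completion_eq_zero F sch C A _ c _ p R (fun y => y ≠ some w)
        fun d hd => ?_).le.trans zero_le
      rw [hu] at hd
      cases hd
      rw [Function.update_self, ← add_assoc, Word_add_self, zero_add, F.decode_encode]
      simp
    · refine (Pr_mono _ fun x hx => hx.1).trans (Pr_completion_le F sch C A _ c hR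
        (by simp [Roles.unique]) _ p fun d hd => ?_)
      rw [Function.update_self]
      refine (hok p u e he d hd).resolve_right ?_
      rintro ⟨-, rfl⟩
      exact hu hd

end Protocol

/-! ### Anonymity, simulation and privacy -/

section Privacy

variable {n m ℓ s : ℕ} (F : AMDCode m ℓ s) (sch : Schedule n ℓ) (C : Finset (Fin n))
  (A : Adversary n) (c : A.Coin)

/-- The remainder of the view after the message rounds with the log `p.1` and the outcomes `d`, if
the veto has the honest input `b d`. -/
noncomputable def viewCompletion (s : ℕ) (p : List (RoundLog n) × Option (Word ℓ))
    (b : Word ℓ → Bool) : PMF (View A) :=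
  match p.2 with
  | none => PMF.pure (c, p.1, [])
  | some d => (vetoPhase s C A c p.1 sch.veto fun _ => b d).map fun q => (c, p.1, q.1)

theorem map_view_completion (S R : Fin n) (w : Word m) (ρ : Fin n → Word ℓ)
    (p : List (RoundLog n) × Option (Word ℓ)) :
    (completion F sch C A (Roles.unique S R w) c ρ p).map Execution.view
      = viewCompletion sch C A c s p fun d => decide (R ∉ C) && (F.decode (d + ρ R)).isNone := by
  unfold completion viewCompletion
  rcases p.2 with _ | d
  · exact PMF.pure_map _ _
  · dsimp only
    rw [PMF.map_comp]
    -- The veto depends only on whether some honest participant objects, so the bit of an honest `R`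
    -- may be given to everybody.
    refine congrArg₂ PMF.map rfl (vetoPhase_congr C A c p.1 sch.veto ?_)
    simp only [Roles.unique, Finset.mem_singleton, Bool.and_eq_true, decide_eq_true_eq]
    constructor
    · rintro ⟨i, hi, rfl, h⟩
      exact ⟨i, hi, hi, h⟩
    · rintro ⟨i, -, hR, h⟩
      exact ⟨R, hR, rfl, h⟩

/-- The identities survive only in the tests of membership in `C`, which is anonymity. -/
theorem viewLaw_unique (S R : Fin n) (w : Word m) :
    viewLaw F sch C A (Roles.unique S R w) = A.coin.bind fun c =>
      (PMF.uniformOfFintype (Word F.coins)).bind fun e =>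
      (PMF.uniformOfFintype (Word ℓ)).bind fun ρ =>
      (messageRounds sch C A c
        ((if S ∈ C then 0 else F.encode w e) + (if R ∈ C then 0 else ρ))).bind fun p =>
      viewCompletion sch C A c s p fun d => decide (R ∉ C) && (F.decode (d + ρ)).isNone := by
  rw [viewLaw, fixedRoleAMT_eq, PMF.map_bind]
  refine bind_congr_fun _ fun c => ?_
  simp_rw [PMF.map_bind, map_view_completion, sum_inputWord_unique]
  rw [uniform_bind_eval S fun e => (PMF.uniformOfFintype (Fin n → Word ℓ)).bind fun ρ =>
    (messageRounds sch C A c ((if S ∈ C then 0 else F.encode w e)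
      + (if R ∈ C then 0 else ρ R))).bind fun p => viewCompletion sch C A c s p fun d =>
        decide (R ∉ C) && (F.decode (d + ρ R)).isNone]
  refine bind_congr_fun _ fun e => ?_
  exact uniform_bind_eval R fun ρ =>
    (messageRounds sch C A c ((if S ∈ C then 0 else F.encode w e)
      + (if R ∈ C then 0 else ρ))).bind fun p => viewCompletion sch C A c s p fun d =>
        decide (R ∉ C) && (F.decode (d + ρ)).isNone

theorem anonymity {S S' R R' : Fin n} (w : Word m) (hS : S ∈ C ↔ S' ∈ C) (hR : R ∈ C ↔ R' ∈ C) :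
    viewLaw F sch C A (Roles.unique S R w) = viewLaw F sch C A (Roles.unique S' R' w) := by
  rw [viewLaw_unique, viewLaw_unique]
  simp only [hS, hR]

/-- The first stage of the simulator. -/
noncomputable def simulateMessage :
    PMF ((A.Coin × List (RoundLog n)) × Option (Word ℓ)) :=
  A.coin.bind fun c => (PMF.uniformOfFintype (Word ℓ)).bind fun u =>
    (messageRounds sch C A c u).map fun p => ((c, p.1), p.2.map (· + u))

/-- The second stage of the simulator. -/
noncomputable def simulateVeto (s : ℕ) (a : A.Coin × List (RoundLog n)) (b : Bool) :
    PMF (List (RoundLog n)) :=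
  if interrupted a.2 then PMF.pure []
  else (vetoPhase s C A a.1 a.2 sch.veto fun _ => b).map Prod.fst

/-- After the change of variables `ρ = u + F.encode w e`, the receiver decodes `F.encode w e + (d +
u)` with fresh `e`, so its veto is the rejection bit for `δ = d + u`. -/
theorem viewLaw_eq_idealView {S R : Fin n} (hS : S ∉ C) (hR : R ∉ C) (w : Word m) :
    viewLaw F sch C A (Roles.unique S R w)
      = idealView F w (simulateMessage sch C A) (simulateVeto sch C A s) := by
  rw [viewLaw_unique, idealView, simulateMessage, PMF.bind_bind]
  refine bind_congr_fun _ fun c => ?_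
  rw [PMF.bind_bind]
  have h1 : ∀ e, ((PMF.uniformOfFintype (Word ℓ)).bind fun ρ =>
      (messageRounds sch C A c
        ((if S ∈ C then 0 else F.encode w e) + (if R ∈ C then 0 else ρ))).bind fun p =>
      viewCompletion sch C A c s p fun d => decide (R ∉ C) && (F.decode (d + ρ)).isNone)
      = (PMF.uniformOfFintype (Word ℓ)).bind fun u =>
        (messageRounds sch C A c u).bind fun p =>
        viewCompletion sch C A c s p fun d =>
          (F.decode (F.encode w e + (d + u))).isNone := by
    intro e
    rw [← uniform_bind_add_right (F.encode w e)]
    refine bind_congr_fun _ fun u => ?_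
    rw [if_neg hS, if_neg hR, add_left_comm, Word_add_self, add_zero]
    simp only [hR, not_false_eq_true, decide_true, Bool.true_and, add_comm, add_left_comm]
  refine (bind_congr_fun _ h1).trans ?_
  rw [PMF.bind_comm]
  refine bind_congr_fun _ fun u => ?_
  rw [PMF.bind_comm, PMF.bind_map]
  refine bind_congr_support _ _ _ fun p hp => ?_
  have hint := isNone_messagePhase C A c _ _ p hp
  rw [Function.comp_apply]
  unfold viewCompletion simulateVeto rejection
  rcases hd : p.2 with _ | d
  · rw [hd] at hint
    simp only [← hint]
    simp [PMF.pure_map]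
  · rw [hd] at hint
    simp only [← hint, Option.map_some, PMF.bind_map]
    refine bind_congr_fun _ fun e => ?_
    simp [PMF.map_comp, Function.comp_def]

theorem rejection_zero (w : Word m) : rejection F w (some 0) = PMF.pure false := by
  simp only [rejection, add_zero, F.decode_encode, Option.isNone_some]
  exact PMF.map_const _ _

/-- Without manipulation `d = u`, hence `δ = 0`, and the rejection bit is constantly `false`. -/
theorem privacy_of_passive (hA : A.Passive C) {S S' R R' : Fin n} (w w' : Word m) (hS : S ∉ C)
    (hS' : S' ∉ C) (hR : R ∉ C) (hR' : R' ∉ C) :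
    viewLaw F sch C A (Roles.unique S R w) = viewLaw F sch C A (Roles.unique S' R' w') := by
  rw [viewLaw_eq_idealView F sch C A hS hR, viewLaw_eq_idealView F sch C A hS' hR', idealView,
    idealView]
  refine bind_congr_support _ _ _ fun a ha => ?_
  have ha2 : a.2 = some 0 := by
    simp only [simulateMessage, PMF.mem_support_bind_iff, PMF.mem_support_map_iff] at ha
    obtain ⟨c, -, u, -, p, hp, rfl⟩ := ha
    have h := messagePhase_of_passive C A c hA _ _ p hp
    -- Every `u` is attained as an honest sum because `S` is honest.
    have hu : ∑ i ∈ Cᶜ, honestWord C u i = u := by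
      have hx := sum_honestInput C
      funext t
      have := hx (Pi.single S (u t))
      rw [show ∑ i ∈ Cᶜ, (Pi.single S (u t) : Fin n → ZMod 2) i = u t by
        simp [Finset.sum_pi_single', hS]] at this
      simpa [honestWord] using this
    simp [h, hu, Word_add_self]
  rw [ha2, rejection_zero, rejection_zero]

/-- The distance of two laws on `Bool` is the difference of their masses at `false`; both lie in
`[0, ε]`, so the error is `ε` and not `2 * ε`. -/
theorem Pr_bind_bool_le {β : Type} (p q : PMF Bool) (f : Bool → PMF β) (E : Set β) (ε : ℝ≥0∞)
    (hp : p false ≤ ε) (hq : q false ≤ ε) : Pr (p.bind f) E ≤ Pr (q.bind f) E + ε := by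
  have hp1 : p true + p false = 1 := by
    rw [← Fintype.sum_bool p, ← p.tsum_coe, tsum_fintype]
  have hq1 : q true + q false = 1 := by
    rw [← Fintype.sum_bool q, ← q.tsum_coe, tsum_fintype]
  simp only [Pr_bind, tsum_fintype, Fintype.sum_bool]
  rcases le_total (q false) (p false) with h | h
  · have ht : p true ≤ q true := by
      have : p true + q false ≤ q true + q false := by
        rw [hq1, ← hp1]
        gcongr
      exact ENNReal.le_of_add_le_add_right (q.apply_ne_top _) this
    calc _ ≤ q true * Pr (f true) E + p false * 1 := by
          gcongr
          exact Pr_le_one _ _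
      _ ≤ q true * Pr (f true) E + q false * Pr (f false) E + ε := by
          rw [mul_one]
          gcongr
          exact le_self_add
  · have ht : p true ≤ q true + q false := by
      rw [hq1]
      exact p.coe_le_one _
    calc _ ≤ (q true + q false) * Pr (f true) E + q false * Pr (f false) E := by gcongr
      _ = q true * Pr (f true) E + q false * Pr (f false) E + q false * Pr (f true) E := by ring
      _ ≤ _ := by
          gcongr
          exact (mul_le_of_le_one_right' (Pr_le_one _ _)).trans hq

theorem statistical_privacy {S S' R R' : Fin n} (w w' : Word m) (hS : S ∉ C)
    (hS' : S' ∉ C) (hR : R ∉ C) (hR' : R' ∉ C) (E : Set (View A)) :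
    Pr (viewLaw F sch C A (Roles.unique S R w)) E
      ≤ Pr (viewLaw F sch C A (Roles.unique S' R' w')) E + (2⁻¹ : ℝ≥0∞) ^ s := by
  rw [viewLaw_eq_idealView F sch C A hS hR, viewLaw_eq_idealView F sch C A hS' hR', idealView,
    idealView]
  refine Pr_bind_mono_add _ _ _ _ _ fun a => ?_
  rcases a.2 with _ | δ
  · exact le_self_add
  by_cases hδ : δ = 0
  · rw [hδ, rejection_zero, rejection_zero]
    exact le_self_add
  · have h : ∀ w : Word m, rejection F w (some δ) false ≤ (2⁻¹ : ℝ≥0∞) ^ s := by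
      intro w
      rw [← PMF.toOuterMeasure_apply_singleton, ← Pr, rejection, Pr_map]
      refine le_trans (Pr_mono _ ?_) (F.detect w δ hδ)
      intro e he
      simpa [Option.isSome_iff_ne_none] using he
    exact Pr_bind_bool_le _ _ _ _ _ (h w) (h w')

end Privacy

/-! ### Several honest senders or receivers -/

section Oracle

variable {n m ℓ s : ℕ} (F : AMDCode m ℓ s) (sch : Schedule n ℓ) (C : Finset (Fin n))
  (A : Adversary n) (roles : Roles n m) (c : A.Coin)

/-- The masks, the log of the message rounds and the outcomes of the message rounds. -/
noncomputable def messageLaw :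
    PMF ((Fin n → Word ℓ) × List (RoundLog n) × Option (Word ℓ)) :=
  (PMF.uniformOfFintype (Fin n → Word F.coins)).bind fun e =>
  (PMF.uniformOfFintype (Fin n → Word ℓ)).bind fun ρ =>
  (messageRounds sch C A c (∑ i ∈ Cᶜ, inputWord F roles e ρ i)).map fun p => (ρ, p)

/-- The event that the receiver `R` accepts. -/
def accepts (R : Fin n) : Set ((Fin n → Word ℓ) × List (RoundLog n) × Option (Word ℓ)) :=
  {q | ∃ d, q.2.2 = some d ∧ F.decode (d + q.1 R) ≠ none}

theorem Pr_not_aborted_le {R : Fin n} (hR : R ∉ C) (hRr : R ∈ roles.recv) (ε : ℝ≥0∞)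
    (h : ∀ c, Pr (messageLaw F sch C A roles c) (accepts F R) ≤ ε) :
    Pr (fixedRoleAMT F sch C A roles) {x | x.aborted = false} ≤ ε + (2⁻¹ : ℝ≥0∞) ^ s := by
  have heq : fixedRoleAMT F sch C A roles = A.coin.bind fun c =>
      (messageLaw F sch C A roles c).bind fun q => completion F sch C A roles c q.1 q.2 := by
    rw [fixedRoleAMT_eq]
    refine bind_congr_fun _ fun c => ?_
    simp only [messageLaw, PMF.bind_bind, PMF.bind_map]
    rfl
  rw [heq]
  refine Pr_bind_le _ _ _ _ fun c => (Pr_bind_le_add _ _ _ (accepts F R) _ fun q hq => ?_).trans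
    (add_le_add_left (h c) _)
  refine Pr_completion_le F sch C A roles c hR hRr _ _ fun d hd => ?_
  by_contra hne
  exact hq ⟨d, hd, hne⟩

/-- The mask of an honest receiver may be replaced by a mask for the sum of the honest inputs. -/
theorem uniform_bind_mask {β : Type} {R : Fin n} (hR : R ∉ C) (hRr : R ∈ roles.recv)
    (e : Fin n → Word F.coins) (f : (Fin n → Word ℓ) → Word ℓ → PMF β) :
    ((PMF.uniformOfFintype (Fin n → Word ℓ)).bind fun ρ =>
      f ρ (∑ i ∈ Cᶜ, inputWord F roles e ρ i))
    = (PMF.uniformOfFintype (Fin n → Word ℓ)).bind fun g =>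
      (PMF.uniformOfFintype (Word ℓ)).bind fun u =>
      f (Function.update g R
        (u + ∑ i ∈ Cᶜ, inputWord F roles e (Function.update g R 0) i)) u := by
  rw [uniform_bind_update R]
  refine bind_congr_fun _ fun g => ?_
  rw [← uniform_bind_add_right (∑ i ∈ Cᶜ, inputWord F roles e (Function.update g R 0) i)]
  refine bind_congr_fun _ fun u => ?_
  rw [sum_inputWord_update_mask F C roles hR hRr e g (u + _), add_assoc, Word_add_self, add_zero]

/-- The mask of `R'` hides the honest sum, so the mask of `R` stays uniform given the outcomes, and
`R` decodes a uniform word. -/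
theorem Pr_accepts_of_two_receivers (hm : 1 ≤ m) {R R' : Fin n} (hne : R ≠ R') (hR' : R' ∉ C)
    (hRr' : R' ∈ roles.recv) :
    Pr (messageLaw F sch C A roles c) (accepts F R) ≤ 2 * (2⁻¹ : ℝ≥0∞) ^ s := by
  refine Pr_bind_le _ _ _ _ fun e => ?_
  rw [uniform_bind_mask F C roles hR' hRr' e fun ρ u =>
    (messageRounds sch C A c u).map fun p => (ρ, p), uniform_bind_update R]
  refine Pr_bind_le _ _ _ _ fun g => ?_
  rw [PMF.bind_comm]
  refine Pr_bind_le _ _ _ _ fun u => ?_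
  simp only [← PMF.bind_pure_comp]
  rw [PMF.bind_comm]
  refine Pr_bind_le _ _ _ _ fun p => ?_
  simp only [Function.comp_def]
  rw [bind_pure_eq_map, Pr_map]
  rcases hp : p.2 with _ | d
  · simp [accepts, hp, Pr]
  · refine le_trans (Pr_mono _ ?_) (Pr_uniform_decode_le F hm d)
    rintro x ⟨d', hd', hx⟩
    obtain rfl : d = d' := by simpa [hp] using hd'
    simpa [hne] using hx

/-- The mask of `R` hides the honest sum, so all encoding coins may be drawn after the message
rounds. Relative to the codeword of `S`, that of `S'` is then part of the manipulation. -/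
theorem Pr_accepts_of_two_senders (hm : 1 ≤ m) {R S S' : Fin n} (hR : R ∉ C)
    (hRr : R ∈ roles.recv) (hne : S ≠ S') (hS : S ∉ C) (hS' : S' ∉ C)
    (hSs : roles.send S ≠ none) (hSs' : roles.send S' ≠ none) :
    Pr (messageLaw F sch C A roles c) (accepts F R) ≤ 2 * (2⁻¹ : ℝ≥0∞) ^ s := by
  obtain ⟨w, hw⟩ := Option.ne_none_iff_exists'.1 hSs
  obtain ⟨w', hw'⟩ := Option.ne_none_iff_exists'.1 hSs'
  have heq : messageLaw F sch C A roles c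
      = (PMF.uniformOfFintype (Fin n → Word ℓ)).bind fun g =>
        (PMF.uniformOfFintype (Word ℓ)).bind fun u =>
        (messageRounds sch C A c u).bind fun p =>
        (PMF.uniformOfFintype (Fin n → Word F.coins)).bind fun e =>
        PMF.pure (Function.update g R
          (u + ∑ i ∈ Cᶜ, inputWord F roles e (Function.update g R 0) i), p) := by
    rw [messageLaw]
    refine (bind_congr_fun _ fun e => uniform_bind_mask F C roles hR hRr e fun ρ u =>
      (messageRounds sch C A c u).map fun p => (ρ, p)).trans ?_
    rw [PMF.bind_comm]
    refine bind_congr_fun _ fun g => ?_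
    rw [PMF.bind_comm]
    refine bind_congr_fun _ fun u => ?_
    simp only [← PMF.bind_pure_comp]
    rw [PMF.bind_comm]
    rfl
  rw [heq]
  refine Pr_bind_le _ _ _ _ fun g => Pr_bind_le _ _ _ _ fun u => Pr_bind_le _ _ _ _ fun p => ?_
  rw [uniform_bind_update S, uniform_bind_update S']
  refine Pr_bind_le _ _ _ _ fun e => ?_
  rcases hp : p.2 with _ | d
  · refine Pr_bind_le _ _ _ _ fun b => Pr_bind_le _ _ _ _ fun a => ?_
    classical
    rw [Pr_pure, if_neg]
    · exact zero_le
    · rintro ⟨d, hd, -⟩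
      simp [hp] at hd
  set ρ₀ := Function.update g R 0
  set k := (if S' ∈ roles.recv then ρ₀ S' else 0)
    + ∑ i ∈ (Cᶜ.erase S).erase S', inputWord F roles e ρ₀ i with hk
  -- `R` decodes `F.encode w a + F.encode w' b + k'`, where `k'` involves neither `a` nor `b`. The
  -- manipulation vanishes only if `F.encode w' b = k'`.
  set k' := d + u + ((if S ∈ roles.recv then ρ₀ S else 0) + k) with hk'
  rw [two_mul]
  refine (Pr_bind_le_add _ _ _ {b | F.encode w' b = k'} _ fun b hb => ?_).trans
    (add_le_add_left (Pr_encode_eq_le F hm w' k') _)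
  simp_rw [sum_inputWord_update_coins F C roles hS hw,
    sum_erase_inputWord_update_coins F C roles hne hS' hw', ← hk]
  rw [bind_pure_eq_map, Pr_map]
  refine le_trans (Pr_mono _ ?_) (F.detect w (F.encode w' b + k') (by rwa [Ne, Word_add_eq_zero]))
  rintro a ⟨d', hd', hx⟩
  obtain rfl : d = d' := by simpa [hp] using hd'
  dsimp only at hx
  rw [Function.update_self] at hx
  rw [Set.mem_ofPred_eq, hk']
  refine fun h => hx (Eq.trans (congrArg F.decode ?_) h)
  abel

end Oracle

theorem mainTheorem4 :
    -- codes with the parameters of the protocol exist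
    (∀ m s : ℕ, 2 ≤ m → Nonempty (AMDCode m (m + 2 * (Nat.clog 2 m + s)) s)) ∧
    ∀ (n m ℓ s : ℕ) (_ : 1 ≤ m) (F : AMDCode m ℓ s) (sch : Schedule n ℓ)
      (C : Finset (Fin n)) (A : Adversary n),
      -- correctness
      (∀ (S R : Fin n) (w : Word m), S ∉ C → R ∉ C →
        Pr (fixedRoleAMT F sch C A (Roles.unique S R w))
            {x | x.aborted = false ∧ ∃ w', x.decoded R = some w' ∧ w' ≠ w}
          ≤ (2⁻¹ : ℝ≥0∞) ^ s ∧
        Pr (fixedRoleAMT F sch C A (Roles.unique S R w))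
            {x | x.aborted = false ∧ x.decoded R ≠ some w}
          ≤ 2 * (2⁻¹ : ℝ≥0∞) ^ s) ∧
      -- privacy: perfect anonymity of the sender and of the receiver
      (∀ (S S' R R' : Fin n) (w : Word m), (S ∈ C ↔ S' ∈ C) → (R ∈ C ↔ R' ∈ C) →
        viewLaw F sch C A (Roles.unique S R w) = viewLaw F sch C A (Roles.unique S' R' w)) ∧
      -- privacy: perfect simulation from the rejection bit alone
      (∃ (sim₁ : PMF ((A.Coin × List (RoundLog n)) × Option (Word ℓ)))
         (sim₂ : A.Coin × List (RoundLog n) → Bool → PMF (List (RoundLog n))),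
        ∀ (S R : Fin n) (w : Word m), S ∉ C → R ∉ C →
          viewLaw F sch C A (Roles.unique S R w) = idealView F w sim₁ sim₂) ∧
      -- privacy: perfect privacy of the message if the corrupt participants do not manipulate it
      (A.Passive C → ∀ (S S' R R' : Fin n) (w w' : Word m), S ∉ C → S' ∉ C → R ∉ C → R' ∉ C →
        viewLaw F sch C A (Roles.unique S R w) = viewLaw F sch C A (Roles.unique S' R' w')) ∧
      -- privacy: what the rejection bit can tell about the message
      (∀ (S S' R R' : Fin n) (w w' : Word m), S ∉ C → S' ∉ C → R ∉ C → R' ∉ C →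
        ∀ E : Set (View A),
          Pr (viewLaw F sch C A (Roles.unique S R w)) E
            ≤ Pr (viewLaw F sch C A (Roles.unique S' R' w')) E + (2⁻¹ : ℝ≥0∞) ^ s) ∧
      -- oracle
      (∀ roles : Roles n m, (∃ R ∈ roles.recv, R ∉ C) →
        ((∃ S S', S ≠ S' ∧ S ∉ C ∧ S' ∉ C ∧ roles.send S ≠ none ∧ roles.send S' ≠ none) ∨
         (∃ R R', R ≠ R' ∧ R ∉ C ∧ R' ∉ C ∧ R ∈ roles.recv ∧ R' ∈ roles.recv)) →
        Pr (fixedRoleAMT F sch C A roles) {x | x.aborted = false} ≤ 3 * (2⁻¹ : ℝ≥0∞) ^ s) := by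
  refine ⟨exists_amdCode, fun n m ℓ s hm F sch C A =>
    ⟨fun S R w hS hR => correctness F sch C A hS hR w,
      fun S S' R R' w hS hR => anonymity F sch C A w hS hR,
      ⟨simulateMessage sch C A, simulateVeto sch C A s,
        fun S R w hS hR => viewLaw_eq_idealView F sch C A hS hR w⟩,
      fun hA S S' R R' w w' hS hS' hR hR' =>
        privacy_of_passive F sch C A hA w w' hS hS' hR hR',
      fun S S' R R' w w' hS hS' hR hR' E =>
        statistical_privacy F sch C A w w' hS hS' hR hR' E,
      fun roles ⟨R₀, hR₀r, hR₀⟩ h => ?_⟩⟩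
  -- Two error terms for acceptance by a receiver, one for a veto that goes unnoticed.
  rw [show (3 : ℝ≥0∞) = 2 + 1 by norm_num, add_mul, one_mul]
  rcases h with ⟨S, S', hne, hS, hS', hSs, hSs'⟩ | ⟨R, R', hne, hR, hR', hRr, hRr'⟩
  · exact Pr_not_aborted_le F sch C A roles hR₀ hR₀r _ fun c =>
      Pr_accepts_of_two_senders F sch C A roles c hm hR₀ hR₀r hne hS hS' hSs hSs'
  · exact Pr_not_aborted_le F sch C A roles hR hRr _ fun c =>
      Pr_accepts_of_two_receivers F sch C A roles c hm hne hR' hRr'
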